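/- Let $\mathbb S=(\mathbb N\cup\{-\infty\},\max,+,-\infty,0)$ be the max-plus semiring and $\Sigma=\{a,b,\#\}$. An \emph{expression} over a set $\mathcal X$ of variables is a formal term built from variables in $\mathcal X$ and constants in $\mathbb S$ with the two operations $\max$ and $+$ of $\mathbb S$; it is \emph{copyless} if every variable occurs in it at most once. A \emph{substitution} is a map $\sigma$ from $\mathcal X$ to expressions over $\mathcal X$; it is \emph{copyless} if every $\sigma(x)$ is copyless and no variable occurs in both $\sigma(x)$ and $\sigma(y)$ for $x\ne y$. A \emph{cost register automaton} (CRA) over $\mathbb S$ and $\Sigma$ consists of a finite set $Q$ of states, a finite set $\mathcal X$ of registers, a transition function $\delta$ assigning to each $(q,c)\in Q\times\Sigma$ a state and a substitution, an initial state $q_0\in Q$, an initial valuation $\nu_0:\mathcal X\to\mathbb S$, and an output expression $\mu(q)$ over $\mathcal X$ for each $q\in Q$. On $w=c_1\cdots c_r$ it runs through configurations $(q_0,\nu_0),\dots,(q_r,\nu_r)$, where $\delta(q_{i-1},c_i)=(q_i,\sigma_i)$ and $\nu_i(x)$ is the value of $\sigma_i(x)$ under $\nu_{i-1}$; it outputs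 the value of $\mu(q_r)$ under $\nu_r$. It is \emph{copyless} if all substitutions occurring in $\delta$ and all expressions $\mu(q)$ are copyless. Let $\mathcal B$ be the CRA with one state and two registers $x,y$, both initially $0$, with the updates $x:=x+1,\ y:=y$ on $a$; $x:=x,\ y:=y+1$ on $b$; $x:=\max\{x,y\},\ y:=0$ on $\#$; and with output $\max\{x,y\}$. Let $f_{\mathcal B}$ be the function that it computes and let $f_{\mathcal B}^R(w)=f_{\mathcal B}(w^r)$, where $w^r$ is the reverse of $w$. For $w=w_0\#w_1\#\cdots\#w_k$ with $w_i\in\{a,b\}^*$ let $n_i$ and $m_i$ be the numbers of $a$'s and of $b$'s in $w_i$, and put $$g(w)=\max_{0\le j\le k}\Big(\sum_{i=0}^{j-1}n_i+m_j\Big).$$ \textbf{Theorem.} (1) The function $g$ is not computed by any copyless CRA, whereas the function $w\mapsto g(w^r)$ is computed by a copyless CRA. (2) The function $f_{\mathcal B}^R$ is not computed by any copyless CRA, whereas its reverse $f_{\mathcal B}$ is computed by a copyless CRA, namely by $\mathcal B$, which is copyless. (3) For every $w\in\Sigma^*$, $f_{\mathcal B}^R(w)=\max\{n_0+\cdots+n_k,\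 g(w)\}$. -/

import Mathlib

/-! ### Expressions and substitutions over a semiring -/

/-- Syntactic expressions over variables in `X`, with constants in `S` and the two binary
operations of the signature of a semiring. -/
inductive SRExpr (S X : Type*) where
  | const (s : S) : SRExpr S X
  | var (x : X) : SRExpr S X
  | add (e₁ e₂ : SRExpr S X) : SRExpr S X
  | mul (e₁ e₂ : SRExpr S X) : SRExpr S X

namespace SRExpr

variable {S X : Type*}

/-- The value of an expression once each variable `x` is replaced by the constant `ν x`. -/
def eval [CommSemiring S] (ν : X → S) : SRExpr S X → S
  | const s => s
  | var x => ν x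
  | add e₁ e₂ => eval ν e₁ + eval ν e₂
  | mul e₁ e₂ => eval ν e₁ * eval ν e₂

/-- The list of all occurrences of variables in an expression, from left to right. -/
def occ : SRExpr S X → List X
  | const _ => []
  | var x => [x]
  | add e₁ e₂ => occ e₁ ++ occ e₂
  | mul e₁ e₂ => occ e₁ ++ occ e₂

/-- An expression is copyless if every variable occurs in it at most once. -/
def Copyless (e : SRExpr S X) : Prop := e.occ.Nodup

/-- A substitution `σ : X → SRExpr S X` is copyless if every `σ x` is copyless and no variable
occurs in both `σ x` and `σ y` when `x ≠ y`. -/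
def CopylessSubst (σ : X → SRExpr S X) : Prop :=
  (∀ x, (σ x).Copyless) ∧ ∀ x y, x ≠ y → List.Disjoint (σ x).occ (σ y).occ

end SRExpr

/-! ### Cost register automata -/

/-- A cost register automaton over the semiring `S` with input alphabet `A`, states `Q` and
registers `X`. Finiteness of `Q` and `X` is required in `CopylessComputable`. -/
structure CRA (S A Q X : Type*) where
  /-- the transition function -/
  δ : Q → A → Q × (X → SRExpr S X)
  /-- the initial state -/
  q₀ : Q
  /-- the initial valuation -/
  ν₀ : X → S
  /-- the final output function -/
  μ : Q → SRExpr S X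

namespace CRA

variable {S A Q X : Type*}

/-- One step on configurations (state, valuation): the new value of `x` is the value of `σ x`
under the old valuation. -/
def step [CommSemiring S] (𝒜 : CRA S A Q X) (c : Q × (X → S)) (a : A) : Q × (X → S) :=
  ((𝒜.δ c.1 a).1, fun x => ((𝒜.δ c.1 a).2 x).eval c.2)

/-- The last configuration of the run over a word. -/
def run [CommSemiring S] (𝒜 : CRA S A Q X) (w : List A) : Q × (X → S) :=
  w.foldl 𝒜.step (𝒜.q₀, 𝒜.ν₀)

/-- The function on words computed by the automaton. -/
def output [CommSemiring S] (𝒜 : CRA S A Q X) (w : List A) : S :=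
  (𝒜.μ (𝒜.run w).1).eval (𝒜.run w).2

/-- A CRA is copyless if the substitutions of all transitions and all output expressions are
copyless. -/
def Copyless (𝒜 : CRA S A Q X) : Prop :=
  (∀ q a, SRExpr.CopylessSubst (𝒜.δ q a).2) ∧ ∀ q, (𝒜.μ q).Copyless

end CRA

/-- `f` is computed by some copyless CRA with finitely many states and registers. (Every finite
set is in bijection with one in `Type`, so the choice of universe is no restriction.) -/
def CopylessComputable {S A : Type*} [CommSemiring S] (f : List A → S) : Prop :=
  ∃ (Q X : Type) (_ : Finite Q) (_ : Finite X) (𝒜 : CRA S A Q X),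
    𝒜.Copyless ∧ ∀ w, 𝒜.output w = f w

/-! ### The max-plus semiring -/

/-- The carrier `ℕ ∪ {-∞}` of the max-plus semiring; `⊥` is `-∞`. -/
def MaxPlus : Type := WithBot ℕ

namespace MaxPlus

/-- The inclusion of `ℕ ∪ {-∞}`. -/
def ofBot (x : WithBot ℕ) : MaxPlus := x

/-- The underlying element of `ℕ ∪ {-∞}`. -/
def toBot (x : MaxPlus) : WithBot ℕ := x

/-- The inclusion of the natural numbers. -/
def ofNat (n : ℕ) : MaxPlus := ofBot (n : WithBot ℕ)

/-- The max-plus semiring: addition is the maximum with neutral element `-∞`, multiplication is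
the usual addition with neutral element `0`. -/
instance : CommSemiring MaxPlus where
  add x y := ofBot (max x.toBot y.toBot)
  zero := ofBot ⊥
  mul x y := ofBot (x.toBot + y.toBot)
  one := ofNat 0
  nsmul := @nsmulRec MaxPlus ⟨ofBot ⊥⟩ ⟨fun x y => ofBot (max x.toBot y.toBot)⟩
  add_assoc x y z := max_assoc (α := WithBot ℕ) x y z
  zero_add x := max_bot_left (α := WithBot ℕ) x
  add_zero x := max_bot_right (α := WithBot ℕ) x
  add_comm x y := max_comm (α := WithBot ℕ) x y
  mul_assoc x y z := add_assoc (G := WithBot ℕ) x y z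
  mul_comm x y := add_comm (G := WithBot ℕ) x y
  one_mul x := zero_add (M := WithBot ℕ) x
  mul_one x := add_zero (M := WithBot ℕ) x
  zero_mul x := WithBot.bot_add (α := ℕ) x
  mul_zero x := WithBot.add_bot (α := ℕ) x
  left_distrib x y z := (max_add_add_left (α := WithBot ℕ) x y z).symm
  right_distrib x y z := (max_add_add_right (α := WithBot ℕ) x y z).symm

theorem ofNat_add (m n : ℕ) : ofNat m + ofNat n = ofNat (max m n) :=
  (WithBot.coe_max m n).symm

theorem ofNat_mul (m n : ℕ) : ofNat m * ofNat n = ofNat (m + n) := rfl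

end MaxPlus

/-! ### The automaton `ℬ` and the functions of the theorem -/

/-- The alphabet `{a, b, #}`. -/
inductive Letter where
  | a : Letter
  | b : Letter
  | hash : Letter
  deriving DecidableEq

/-- The two registers of `ℬ`. -/
inductive Reg where
  | x : Reg
  | y : Reg
  deriving DecidableEq

/-- The substitutions of `ℬ`: on `a`, `x := x + 1, y := y`; on `b`, `x := x, y := y + 1`;
on `#`, `x := max {x, y}, y := 0`. -/
def substB : Letter → Reg → SRExpr MaxPlus Reg
  | .a, .x => .mul (.var .x) (.const (MaxPlus.ofNat 1))
  | .a, .y => .var .y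
  | .b, .x => .var .x
  | .b, .y => .mul (.var .y) (.const (MaxPlus.ofNat 1))
  | .hash, .x => .add (.var .x) (.var .y)
  | .hash, .y => .const (MaxPlus.ofNat 0)

/-- The one-state automaton `ℬ`, with `x, y := 0` initially and output `max {x, y}`. -/
def automatonB : CRA MaxPlus Letter Unit Reg where
  δ _ c := ((), substB c)
  q₀ := ()
  ν₀ _ := MaxPlus.ofNat 0
  μ _ := .add (.var .x) (.var .y)

/-- The reverse of the function computed by `ℬ`. -/
def fBR (w : List Letter) : MaxPlus := automatonB.output w.reverse

/-- The number of occurrences of the letter `c` in the `i`-th block `w_i` of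
`w = w_0 # w_1 # ⋯ # w_k`. -/
def blockCount (c : Letter) (w : List Letter) (i : ℕ) : ℕ :=
  ((w.splitOn Letter.hash).getD i []).count c

/-- `max_{0 ≤ j ≤ k} (n_0 + ⋯ + n_{j-1}) + m_j`, where `k` is the number of `#` in `w`, and `n_i`
and `m_i` are the numbers of `a` and of `b` in the `i`-th block of `w`. -/
def blockMax (w : List Letter) : ℕ :=
  (Finset.range (w.count Letter.hash + 1)).sup fun j =>
    (∑ i ∈ Finset.range j, blockCount Letter.a w i) + blockCount Letter.b w j

/-!
The positive statements rest on one computation: if `ℬ` is started with the value `s` in the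
register `x` and reads the reverse of `w`, then it outputs the maximum of `s + n_0 + ⋯ + n_k` and
`g w` (`output_automatonBFrom_reverse`), where `g` is `blockMax`. The value `s = 0` gives `f_ℬ^R`,
and `s = -∞` gives `g`.
In particular both functions agree on words that end with `#`, so that it suffices to show that no
copyless automaton computes `f_ℬ^R` on these words.

Suppose that one does. Recording in the states which registers are `-∞`, one may assume that all
values are natural numbers (`CRA.simplify`). Every expression is then read-once over
`(ℕ, max, +)`: it is a maximum of multilinear monomials in which every occurring variable counts,
and, by copylessness, a register flows into at most one register at any later time. Choose `N` such
that all words `c ^ N` act idempotently on the states and on the flow of registers. Then along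
`c ^ (N * (n + 1))` each register either grows linearly in `n` or stays bounded relative to its
value at `n = 0` (`CRA.IsStable.growth_dichotomy`). Consider words with blocks
`b ^ (N * (m_i + 1)) a ^ (N * (n_i + 1)) #`, and call a register tight at some time if it occurs in
a monomial of the remaining computation that attains the output.

The test word of index `l` has `n_i = t` for `i < l`, `m_l = z`, and all other exponents `0`, where
`t` is large and `z` much larger. Its output is the term of index `l` of the maximum `g`. As the
`a`'s of a block `s < l` contribute to it, they are counted by a register that is tight when this
block has been read (`CRA.IsGrowthBound.exists_tightAt`). For sufficiently many indices, a
Ramsey-type selection (`exists_end_homogeneous`) makes this register depend on `s` only, on a set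
of more than `card X + 1` indices. Let `r` be the largest of them. By the pigeonhole principle
there are `s < l < r` such that the registers of `s` and of `l` flow into the same register `x`
before the block of index `r`. So `x` counts the `a`'s of the block `l` and is tight both for the
test word of index `l` (because of `s`) and for that of index `r`. This is impossible
(`CRA.IsGrowthBound.not_tightAt`): raising `n_l` to about `z` does not change the output on the
test word of index `l`, so `x` was already of size about `z` there, which it can only be by
counting the `b`'s of the block `l`; but raising `m_l` to `z` does not change the output on the
test word of index `r` either, so there `x` was of size about `z` before the block `r`, although
no large exponent had been read.
-/

/-! ### Substitution and copylessness -/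

namespace SRExpr

variable {S X Y : Type*}

/-- The expression obtained by replacing every variable `x` by the expression `σ x`. -/
def subst {Y : Type*} (σ : X → SRExpr S Y) : SRExpr S X → SRExpr S Y
  | const s => const s
  | var x => σ x
  | add e₁ e₂ => add (subst σ e₁) (subst σ e₂)
  | mul e₁ e₂ => mul (subst σ e₁) (subst σ e₂)

theorem occ_subst (σ : X → SRExpr S Y) (e : SRExpr S X) :
    (e.subst σ).occ = e.occ.flatMap fun x => (σ x).occ := by
  induction e <;> simp_all [subst, occ]

theorem subst_subst {Z : Type*} (σ : X → SRExpr S Y) (τ : Y → SRExpr S Z) (e : SRExpr S X) :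
    (e.subst σ).subst τ = e.subst fun x => (σ x).subst τ := by
  induction e <;> simp_all [subst]

theorem subst_var (e : SRExpr S X) : e.subst var = e := by
  induction e <;> simp_all [subst]

theorem Copyless.subst {e : SRExpr S X} (he : e.Copyless) {σ : X → SRExpr S X}
    (hσ : CopylessSubst σ) : (e.subst σ).Copyless := by
  unfold Copyless
  rw [occ_subst, List.nodup_flatMap]
  exact ⟨fun x _ => hσ.1 x, List.Pairwise.imp (fun h => hσ.2 _ _ h) he⟩

theorem CopylessSubst.comp {σ τ : X → SRExpr S X} (hσ : CopylessSubst σ)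
    (hτ : CopylessSubst τ) : CopylessSubst fun x => (τ x).subst σ := by
  refine ⟨fun x => (hτ.1 x).subst hσ, fun x y hxy => ?_⟩
  simp only [occ_subst]
  intro z hz hz'
  obtain ⟨u, hu, hzu⟩ := List.mem_flatMap.1 hz
  obtain ⟨v, hv, hzv⟩ := List.mem_flatMap.1 hz'
  by_cases huv : u = v
  · subst huv
    exact hτ.2 x y hxy hu hv
  · exact hσ.2 u v huv hzu hzv

theorem CopylessSubst.eq_of_mem {σ : X → SRExpr S X} (hσ : CopylessSubst σ) {x y z : X}
    (hx : z ∈ (σ x).occ) (hy : z ∈ (σ y).occ) : x = y := by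
  by_contra h
  exact hσ.2 x y h hx hy

theorem Copyless.of_add {e₁ e₂ : SRExpr S X} (h : (add e₁ e₂).Copyless) :
    e₁.Copyless ∧ e₂.Copyless ∧ List.Disjoint e₁.occ e₂.occ :=
  List.nodup_append'.1 h

theorem Copyless.of_mul {e₁ e₂ : SRExpr S X} (h : (mul e₁ e₂).Copyless) :
    e₁.Copyless ∧ e₂.Copyless ∧ List.Disjoint e₁.occ e₂.occ :=
  List.nodup_append'.1 h

/-! ### Read-once expressions over `(ℕ, max, +)` -/

/-- The value in `ℕ` of an expression with constants in `ℕ`, where `add` is read as the maximum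
and `mul` as the sum, as in the max-plus semiring. -/
def natEval (ν : X → ℕ) : SRExpr ℕ X → ℕ
  | const s => s
  | var x => ν x
  | add e₁ e₂ => max (natEval ν e₁) (natEval ν e₂)
  | mul e₁ e₂ => natEval ν e₁ + natEval ν e₂

theorem natEval_subst (ν : Y → ℕ) (σ : X → SRExpr ℕ Y) (e : SRExpr ℕ X) :
    (e.subst σ).natEval ν = e.natEval fun x => (σ x).natEval ν := by
  induction e <;> simp_all [subst, natEval]

theorem natEval_congr {ν ν' : X → ℕ} (e : SRExpr ℕ X) (h : ∀ x ∈ e.occ, ν x = ν' x) :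
    e.natEval ν = e.natEval ν' := by
  induction e with
  | const s => rfl
  | var x => exact h x (by simp [occ])
  | add e₁ e₂ h₁ h₂ =>
    simp only [natEval]
    rw [h₁ fun x hx => h x (by simp [occ, hx]), h₂ fun x hx => h x (by simp [occ, hx])]
  | mul e₁ e₂ h₁ h₂ =>
    simp only [natEval]
    rw [h₁ fun x hx => h x (by simp [occ, hx]), h₂ fun x hx => h x (by simp [occ, hx])]

theorem natEval_le_add_length {ν ν' : X → ℕ} {C : ℕ} (e : SRExpr ℕ X)
    (h : ∀ x ∈ e.occ, ν x ≤ ν' x + C) : e.natEval ν ≤ e.natEval ν' + e.occ.length * C := by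
  induction e with
  | const s => simp [natEval]
  | var x => simpa [natEval, occ] using h x (by simp [occ])
  | add e₁ e₂ h₁ h₂ =>
    have h₁ := h₁ fun x hx => h x (by simp [occ, hx])
    have h₂ := h₂ fun x hx => h x (by simp [occ, hx])
    simp only [natEval, occ, List.length_append, add_mul]
    omega
  | mul e₁ e₂ h₁ h₂ =>
    have h₁ := h₁ fun x hx => h x (by simp [occ, hx])
    have h₂ := h₂ fun x hx => h x (by simp [occ, hx])
    simp only [natEval, occ, List.length_append, add_mul]
    omega

theorem natEval_mono {ν ν' : X → ℕ} (e : SRExpr ℕ X) (h : ∀ x, ν x ≤ ν' x) :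
    e.natEval ν ≤ e.natEval ν' := by
  simpa using natEval_le_add_length (C := 0) e fun x _ => h x

theorem Copyless.natEval_le_add [Fintype X] {ν ν' : X → ℕ} {C : ℕ} {e : SRExpr ℕ X}
    (he : e.Copyless) (h : ∀ x ∈ e.occ, ν x ≤ ν' x + C) :
    e.natEval ν ≤ e.natEval ν' + Fintype.card X * C := by
  refine (natEval_le_add_length e h).trans ?_
  have := Nat.mul_le_mul_right C (List.Nodup.length_le_card he)
  omega

/-- Since `-∞` is not available, no occurrence of a variable is ever ignored. -/
theorem le_natEval_of_mem_occ {ν : X → ℕ} {e : SRExpr ℕ X} {x : X} (hx : x ∈ e.occ) :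
    ν x ≤ e.natEval ν := by
  induction e with
  | const s => simp [occ] at hx
  | var y => simp_all [occ, natEval]
  | add e₁ e₂ h₁ h₂ =>
    simp only [occ, List.mem_append, natEval] at hx ⊢
    rcases hx with hx | hx
    · exact (h₁ hx).trans (le_max_left _ _)
    · exact (h₂ hx).trans (le_max_right _ _)
  | mul e₁ e₂ h₁ h₂ =>
    simp only [occ, List.mem_append, natEval] at hx ⊢
    rcases hx with hx | hx
    · have := h₁ hx
      omega
    · have := h₂ hx
      omega

theorem natEval_update_of_notMem [DecidableEq X] {ν : X → ℕ} {e : SRExpr ℕ X} {x : X}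
    (hx : x ∉ e.occ) (h : ℕ) : e.natEval (Function.update ν x h) = e.natEval ν :=
  natEval_congr e fun y hy => Function.update_of_ne (by rintro rfl; exact hx hy) _ _

/-- As a function of a single variable, a read-once expression is a tropical line of slope one. -/
theorem Copyless.exists_natEval_update [DecidableEq X] {e : SRExpr ℕ X} (he : e.Copyless) {x : X}
    (hx : x ∈ e.occ) (ν : X → ℕ) :
    ∃ A B : ℕ, ∀ h, e.natEval (Function.update ν x h) = max (A + h) B := by
  induction e with
  | const s => simp [occ] at hx
  | var y =>
    obtain rfl : x = y := by simpa [occ] using hx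
    exact ⟨0, 0, fun h => by simp [natEval]⟩
  | add e₁ e₂ h₁ h₂ =>
    obtain ⟨he₁, he₂, hd⟩ := he.of_add
    simp only [occ, List.mem_append] at hx
    rcases hx with hx | hx
    · obtain ⟨A, B, hAB⟩ := h₁ he₁ hx
      refine ⟨A, max B (e₂.natEval ν), fun h => ?_⟩
      rw [natEval, hAB, natEval_update_of_notMem (hd hx), max_assoc]
    · obtain ⟨A, B, hAB⟩ := h₂ he₂ hx
      refine ⟨A, max B (e₁.natEval ν), fun h => ?_⟩
      rw [natEval, hAB, natEval_update_of_notMem fun hx' => hd hx' hx]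
      omega
  | mul e₁ e₂ h₁ h₂ =>
    obtain ⟨he₁, he₂, hd⟩ := he.of_mul
    simp only [occ, List.mem_append] at hx
    rcases hx with hx | hx
    · obtain ⟨A, B, hAB⟩ := h₁ he₁ hx
      refine ⟨A + e₂.natEval ν, B + e₂.natEval ν, fun h => ?_⟩
      rw [natEval, hAB, natEval_update_of_notMem (hd hx)]
      omega
    · obtain ⟨A, B, hAB⟩ := h₂ he₂ hx
      refine ⟨A + e₁.natEval ν, B + e₁.natEval ν, fun h => ?_⟩
      rw [natEval, hAB, natEval_update_of_notMem fun hx' => hd hx' hx]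
      omega

theorem Copyless.natEval_update_add_le [DecidableEq X] {e : SRExpr ℕ X} (he : e.Copyless)
    (ν : X → ℕ) (x : X) (d : ℕ) :
    e.natEval (Function.update ν x (ν x + d)) ≤ e.natEval ν + d := by
  by_cases hx : x ∈ e.occ
  · obtain ⟨A, B, hAB⟩ := he.exists_natEval_update hx ν
    have h := hAB (ν x)
    rw [Function.update_eq_self] at h
    rw [hAB, h]
    omega
  · rw [natEval_update_of_notMem hx]
    omega

/-- At every valuation some multilinear monomial of a read-once expression attains its value. -/
theorem Copyless.exists_monomial {e : SRExpr ℕ X} (he : e.Copyless) (ν : X → ℕ) :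
    ∃ (s : Finset X) (c : ℕ), (∀ x ∈ s, x ∈ e.occ) ∧ e.natEval ν = c + ∑ x ∈ s, ν x ∧
      ∀ ν' : X → ℕ, c + ∑ x ∈ s, ν' x ≤ e.natEval ν' := by
  classical
  induction e with
  | const s => exact ⟨∅, s, by simp [natEval]⟩
  | var x => exact ⟨{x}, 0, by simp [natEval, occ]⟩
  | add e₁ e₂ h₁ h₂ =>
    obtain ⟨he₁, he₂, hd⟩ := he.of_add
    obtain ⟨s₁, c₁, ho₁, hv₁, hl₁⟩ := h₁ he₁
    obtain ⟨s₂, c₂, ho₂, hv₂, hl₂⟩ := h₂ he₂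
    rcases le_total (e₁.natEval ν) (e₂.natEval ν) with h | h
    · refine ⟨s₂, c₂, fun x hx => by simp [occ, ho₂ x hx], ?_, fun ν' => ?_⟩
      · rw [natEval, max_eq_right h, hv₂]
      · exact (hl₂ ν').trans (le_max_right _ _)
    · refine ⟨s₁, c₁, fun x hx => by simp [occ, ho₁ x hx], ?_, fun ν' => ?_⟩
      · rw [natEval, max_eq_left h, hv₁]
      · exact (hl₁ ν').trans (le_max_left _ _)
  | mul e₁ e₂ h₁ h₂ =>
    obtain ⟨he₁, he₂, hd⟩ := he.of_mul
    obtain ⟨s₁, c₁, ho₁, hv₁, hl₁⟩ := h₁ he₁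
    obtain ⟨s₂, c₂, ho₂, hv₂, hl₂⟩ := h₂ he₂
    have hs : Disjoint s₁ s₂ :=
      Finset.disjoint_left.2 fun x hx hx' => hd (ho₁ x hx) (ho₂ x hx')
    refine ⟨s₁ ∪ s₂, c₁ + c₂, fun x hx => ?_, ?_, fun ν' => ?_⟩
    · rcases Finset.mem_union.1 hx with hx | hx
      · simp [occ, ho₁ x hx]
      · simp [occ, ho₂ x hx]
    · rw [natEval, hv₁, hv₂, Finset.sum_union hs]
      omega
    · have h₁ := hl₁ ν'
      have h₂ := hl₂ ν'
      rw [natEval, Finset.sum_union hs]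
      omega

/-! ### Tight variables -/

/-- A variable `y` is tight in `e` at `ν` if raising `y` raises the value of `e` by the same
amount, that is, if `y` occurs in a monomial of `e` that attains the value at `ν`. -/
def Tight [DecidableEq X] (e : SRExpr ℕ X) (ν : X → ℕ) (y : X) : Prop :=
  ∀ d, e.natEval ν + d ≤ e.natEval (Function.update ν y (ν y + d))

theorem tight_of_mem_monomial [DecidableEq X] {e : SRExpr ℕ X} {ν : X → ℕ} {s : Finset X} {c : ℕ}
    (hv : e.natEval ν = c + ∑ x ∈ s, ν x) (hl : ∀ ν' : X → ℕ, c + ∑ x ∈ s, ν' x ≤ e.natEval ν')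
    {y : X} (hy : y ∈ s) : e.Tight ν y := by
  intro d
  refine le_trans ?_ (hl _)
  rw [hv, Finset.sum_update_of_mem hy, ← Finset.add_sum_erase s ν hy, Finset.sdiff_singleton_eq_erase]
  omega

/-- Tightness is transported forwards along a copyless substitution. -/
theorem Tight.exists_of_subst [DecidableEq X] {e : SRExpr ℕ X} {σ : X → SRExpr ℕ X}
    (hσ : CopylessSubst σ) {ν : X → ℕ} {y : X} (h : (e.subst σ).Tight ν y) :
    ∃ x, y ∈ (σ x).occ ∧ e.Tight (fun z => (σ z).natEval ν) x := by
  simp only [Tight, natEval_subst] at h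
  by_cases hx : ∃ x, y ∈ (σ x).occ
  · obtain ⟨x, hx⟩ := hx
    refine ⟨x, hx, fun d => (h d).trans (natEval_mono e fun z => ?_)⟩
    by_cases hz : z = x
    · subst hz
      rw [Function.update_self]
      exact (hσ.1 z).natEval_update_add_le ν y d
    · rw [Function.update_of_ne hz, natEval_update_of_notMem fun hy => hz (hσ.eq_of_mem hy hx)]
  · push Not at hx
    have h1 := h 1
    simp only [natEval_update_of_notMem (hx _)] at h1
    omega

/-- If passing from `ν` to `ν'` neither raises the value of `e` nor lowers a variable by more than
`C`, then it cannot raise a tight variable substantially. -/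
theorem Tight.le_add [DecidableEq X] [Fintype X] {e : SRExpr ℕ X} (he : e.Copyless)
    {ν ν' : X → ℕ} {y : X} (h : e.Tight ν y) {C : ℕ} (hν : ∀ x, ν x ≤ ν' x + C)
    (hle : e.natEval ν' ≤ e.natEval ν) : ν' y ≤ ν y + Fintype.card X * C := by
  have h1 := h (ν' y - ν y)
  have h2 : e.natEval (Function.update ν y (ν y + (ν' y - ν y))) ≤
      e.natEval ν' + Fintype.card X * C := by
    refine he.natEval_le_add fun x _ => ?_
    by_cases hx : x = y
    · subst hx
      have := hν x
      rw [Function.update_self]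
      omega
    · rw [Function.update_of_ne hx]
      exact hν x
  omega

end SRExpr

/-! ### Automata as substitutions -/

theorem exists_pow_idempotent {M : Type*} [Monoid M] [Finite M] (a : M) :
    ∃ N, 0 < N ∧ a ^ N * a ^ N = a ^ N := by
  obtain ⟨i, j, hne, hij⟩ := Finite.exists_ne_map_eq_of_infinite fun n : ℕ => a ^ n
  wlog hlt : i < j generalizing i j
  · exact this j i hne.symm hij.symm (by omega)
  obtain ⟨p, rfl⟩ := Nat.exists_eq_add_of_lt hlt
  have hper : ∀ k n, i ≤ n → a ^ (n + k * (p + 1)) = a ^ n := by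
    intro k n hn
    induction k with
    | zero => simp
    | succ k ih =>
      obtain ⟨m, rfl⟩ := Nat.exists_eq_add_of_le hn
      have h : a ^ i = a ^ (i + (p + 1)) := hij
      rw [← ih, show i + m + (k + 1) * (p + 1) = i + (p + 1) + (m + k * (p + 1)) by ring,
        pow_add, ← h, ← pow_add, add_assoc]
  refine ⟨(i + 1) * (p + 1), by positivity, ?_⟩
  rw [← pow_add]
  exact hper _ _ (by nlinarith)

namespace CRA

open SRExpr

variable {S A Q X : Type*}

/-- The state reached from `q` by reading a word. -/
def stateAfter (𝒜 : CRA S A Q X) (q : Q) (w : List A) : Q :=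
  w.foldl (fun q c => (𝒜.δ q c).1) q

/-- The substitution performed by reading a word from the state `q`. -/
def wordSubst (𝒜 : CRA S A Q X) : Q → List A → X → SRExpr S X
  | _, [] => var
  | q, c :: w => fun x => (wordSubst 𝒜 (𝒜.δ q c).1 w x).subst (𝒜.δ q c).2

theorem stateAfter_append (𝒜 : CRA S A Q X) (q : Q) (u v : List A) :
    𝒜.stateAfter q (u ++ v) = 𝒜.stateAfter (𝒜.stateAfter q u) v :=
  List.foldl_append

theorem wordSubst_append (𝒜 : CRA S A Q X) (q : Q) (u v : List A) (x : X) :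
    𝒜.wordSubst q (u ++ v) x =
      (𝒜.wordSubst (𝒜.stateAfter q u) v x).subst (𝒜.wordSubst q u) := by
  induction u generalizing q with
  | nil => exact (subst_var _).symm
  | cons c u ih =>
    simp only [List.cons_append, wordSubst, ih, subst_subst]
    rfl

theorem Copyless.wordSubst {𝒜 : CRA S A Q X} (h𝒜 : 𝒜.Copyless) (q : Q) (w : List A) :
    CopylessSubst (𝒜.wordSubst q w) := by
  induction w generalizing q with
  | nil =>
    exact ⟨fun x => List.nodup_singleton x, fun x y hxy => by
      simpa [CRA.wordSubst, occ, eq_comm] using hxy⟩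
  | cons c w ih => exact (h𝒜.1 q c).comp (ih _)

/-- The output of the automaton as an expression in the registers before reading `w`
from the state `q`. -/
def outExpr (𝒜 : CRA S A Q X) (q : Q) (w : List A) : SRExpr S X :=
  (𝒜.μ (𝒜.stateAfter q w)).subst (𝒜.wordSubst q w)

theorem outExpr_append (𝒜 : CRA S A Q X) (q : Q) (u v : List A) :
    𝒜.outExpr q (u ++ v) = (𝒜.outExpr (𝒜.stateAfter q u) v).subst (𝒜.wordSubst q u) := by
  simp only [outExpr, stateAfter_append, subst_subst]
  congr 1
  funext x
  exact wordSubst_append 𝒜 q u v x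

theorem Copyless.outExpr {𝒜 : CRA S A Q X} (h𝒜 : 𝒜.Copyless) (q : Q) (w : List A) :
    (𝒜.outExpr q w).Copyless :=
  (h𝒜.2 _).subst (h𝒜.wordSubst q w)

/-! ### Flow of registers -/

/-- The register `y` flows to `x` along `w` from `q` if the value of `x` after `w` is computed
from the value of `y` before `w`. -/
def Flows (𝒜 : CRA S A Q X) (q : Q) (w : List A) (y x : X) : Prop :=
  y ∈ (𝒜.wordSubst q w x).occ

theorem flows_append {𝒜 : CRA S A Q X} {q : Q} {u v : List A} {y x : X} :
    𝒜.Flows q (u ++ v) y x ↔ ∃ z, 𝒜.Flows q u y z ∧ 𝒜.Flows (𝒜.stateAfter q u) v z x := by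
  simp only [Flows, wordSubst_append, occ_subst, List.mem_flatMap]
  exact exists_congr fun z => and_comm

/-- The action of a word on pairs of a state and a set of registers, the latter being moved along
the flow. -/
def flowMap (𝒜 : CRA S A Q X) (w : List A) (p : Q × Set X) : Q × Set X :=
  (𝒜.stateAfter p.1 w, {x | ∃ y ∈ p.2, 𝒜.Flows p.1 w y x})

theorem flowMap_append (𝒜 : CRA S A Q X) (u v : List A) :
    𝒜.flowMap (u ++ v) = 𝒜.flowMap v ∘ 𝒜.flowMap u := by
  funext p
  refine Prod.ext (stateAfter_append 𝒜 _ _ _) (Set.ext fun x => ?_)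
  simp only [flowMap, flows_append, Function.comp_apply, Set.mem_ofPred_eq]
  constructor
  · rintro ⟨y, hy, z, hz, hzx⟩
    exact ⟨z, ⟨y, hy, hz⟩, hzx⟩
  · rintro ⟨z, ⟨y, hy, hz⟩, hzx⟩
    exact ⟨y, hy, z, hz, hzx⟩

theorem flowMap_nil (𝒜 : CRA S A Q X) : 𝒜.flowMap [] = id := by
  funext p
  refine Prod.ext rfl (Set.ext fun x => ?_)
  simp [flowMap, Flows, wordSubst, occ]

theorem flowMap_replicate (𝒜 : CRA S A Q X) (w : A) (n : ℕ) :
    𝒜.flowMap (List.replicate n w) = (𝒜.flowMap [w])^[n] := by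
  induction n with
  | zero => exact flowMap_nil 𝒜
  | succ n ih =>
    rw [List.replicate_succ', flowMap_append, ih, Function.iterate_succ']

theorem stateAfter_eq_of_flowMap_eq {𝒜 : CRA S A Q X} {u v : List A}
    (h : 𝒜.flowMap u = 𝒜.flowMap v) (q : Q) : 𝒜.stateAfter q u = 𝒜.stateAfter q v :=
  congrArg Prod.fst (congrFun h (q, ∅))

theorem flows_iff_of_flowMap_eq {𝒜 : CRA S A Q X} {u v : List A}
    (h : 𝒜.flowMap u = 𝒜.flowMap v) (q : Q) (y x : X) : 𝒜.Flows q u y x ↔ 𝒜.Flows q v y x := by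
  have := Set.ext_iff.1 (congrArg Prod.snd (congrFun h (q, {y}))) x
  simpa [flowMap] using this

/-- `N` is a stable exponent if for every letter `c` the word `c ^ N` acts idempotently on states
and on the flow of registers. -/
def IsStable (𝒜 : CRA S A Q X) (N : ℕ) : Prop :=
  0 < N ∧ ∀ c, 𝒜.flowMap (List.replicate (N + N) c) = 𝒜.flowMap (List.replicate N c)

theorem exists_isStable [Finite A] [Finite Q] [Finite X] (𝒜 : CRA S A Q X) :
    ∃ N, 𝒜.IsStable N := by
  have : Finite (Function.End (Q × Set X)) := inferInstanceAs (Finite (Q × Set X → Q × Set X))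
  let F : A → Function.End (Q × Set X) := fun c => 𝒜.flowMap [c]
  obtain ⟨N, hN, h⟩ := exists_pow_idempotent F
  refine ⟨N, hN, fun c => ?_⟩
  have hp : ∀ n, (F ^ n) c = 𝒜.flowMap (List.replicate n c) := by
    intro n
    rw [flowMap_replicate]
    induction n with
    | zero => rfl
    | succ n ih =>
      rw [pow_succ', Pi.mul_apply, ih, Function.iterate_succ']
      rfl
  rw [← hp, ← hp, pow_add, h]

/-- The word `c ^ (N * (n + 1))`. -/
abbrev power (N : ℕ) (c : A) (n : ℕ) : List A := List.replicate (N * (n + 1)) c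

theorem power_succ (N : ℕ) (c : A) (n : ℕ) :
    power N c (n + 1) = power N c n ++ List.replicate N c := by
  rw [power, power, List.replicate_append_replicate]
  congr 1

theorem IsStable.flowMap_power {𝒜 : CRA S A Q X} {N : ℕ} (hN : 𝒜.IsStable N) (c : A) (n : ℕ) :
    𝒜.flowMap (power N c n) = 𝒜.flowMap (List.replicate N c) := by
  induction n with
  | zero => rw [power, zero_add, mul_one]
  | succ n ih =>
    rw [power_succ, flowMap_append, ih, ← flowMap_append, List.replicate_append_replicate, hN.2]

theorem IsStable.flowMap_power_eq {𝒜 : CRA S A Q X} {N : ℕ} (hN : 𝒜.IsStable N) (c : A)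
    (n n' : ℕ) : 𝒜.flowMap (power N c n) = 𝒜.flowMap (power N c n') := by
  rw [hN.flowMap_power, hN.flowMap_power]

/-! ### Growth of registers along powers of a letter -/

section Growth

variable {𝒜 : CRA ℕ A Q X}

/-- The valuation after reading `w` from the configuration `(q, ν)`. -/
def val (𝒜 : CRA ℕ A Q X) (q : Q) (w : List A) (ν : X → ℕ) (x : X) : ℕ :=
  (𝒜.wordSubst q w x).natEval ν

theorem val_cons (𝒜 : CRA ℕ A Q X) (q : Q) (c : A) (w : List A) (ν : X → ℕ) :
    𝒜.val q (c :: w) ν =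
      𝒜.val (𝒜.δ q c).1 w fun x => ((𝒜.δ q c).2 x).natEval ν := by
  funext x
  simp only [val, wordSubst, natEval_subst]

theorem val_append (𝒜 : CRA ℕ A Q X) (q : Q) (u v : List A) (ν : X → ℕ) :
    𝒜.val q (u ++ v) ν = 𝒜.val (𝒜.stateAfter q u) v (𝒜.val q u ν) := by
  funext x
  simp only [val, wordSubst_append, natEval_subst]
  rfl

theorem natEval_outExpr_append (𝒜 : CRA ℕ A Q X) (q : Q) (u v : List A) (ν : X → ℕ) :
    (𝒜.outExpr q (u ++ v)).natEval ν =
      (𝒜.outExpr (𝒜.stateAfter q u) v).natEval (𝒜.val q u ν) := by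
  rw [outExpr_append, natEval_subst]
  rfl

theorem Flows.le_val {q : Q} {w : List A} {y x : X} (h : 𝒜.Flows q w y x) (ν : X → ℕ) :
    ν y ≤ 𝒜.val q w ν x :=
  le_natEval_of_mem_occ h

/-- Along the powers of a letter, a register either grows linearly, whatever the valuation before,
or by at most a constant, and it never loses more than a constant. The reason is that once the
flow is idempotent, a register that is not reset is updated by `x := max (A + x, B)` with constants
`A` and `B`: all other registers it reads have been reset. It grows if `A ≠ 0`. -/
theorem IsStable.growth_dichotomy {N : ℕ} (hN : 𝒜.IsStable N) (h𝒜 : 𝒜.Copyless) (q : Q) (c : A)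
    (x : X) :
    ∃ C, (∀ ν n, 𝒜.val q (power N c 0) ν x ≤ 𝒜.val q (power N c n) ν x + C) ∧
      ((∀ ν n, n ≤ 𝒜.val q (power N c n) ν x + C) ∨
        ∀ ν n, 𝒜.val q (power N c n) ν x ≤ 𝒜.val q (power N c 0) ν x + C) := by
  classical
  set w := List.replicate N c with hw
  have hw0 : power N c 0 = w := by simp [hw]
  have hww : 𝒜.flowMap (w ++ w) = 𝒜.flowMap w := by
    rw [hw, List.replicate_append_replicate, hN.2]
  set r := 𝒜.stateAfter q w with hr
  have hrr : 𝒜.stateAfter r w = r := by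
    rw [hr, ← stateAfter_append, stateAfter_eq_of_flowMap_eq hww]
  have hidem : ∀ y z, 𝒜.Flows r w y z ↔ ∃ u, 𝒜.Flows r w y u ∧ 𝒜.Flows r w u z := fun y z => by
    rw [← flows_iff_of_flowMap_eq hww, flows_append, hrr]
  have hidem' : ∀ y z, 𝒜.Flows q w y z ↔ ∃ u, 𝒜.Flows q w y u ∧ 𝒜.Flows r w u z := fun y z => by
    rw [← flows_iff_of_flowMap_eq hww, flows_append]
  have huniq : ∀ {y z z'}, 𝒜.Flows r w y z → 𝒜.Flows r w y z' → z = z' :=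
    fun h h' => (h𝒜.wordSubst r w).eq_of_mem h h'
  have hself : ∀ {y z}, 𝒜.Flows r w y z → 𝒜.Flows r w z z := fun {y z} h => by
    obtain ⟨u, hu, huz⟩ := (hidem y z).1 h
    rwa [huniq hu h] at huz
  have hsucc : ∀ ν n, 𝒜.val q (power N c (n + 1)) ν = 𝒜.val r w (𝒜.val q (power N c n) ν) := by
    intro ν n
    rw [power_succ, val_append, stateAfter_eq_of_flowMap_eq (hN.flowMap_power c n)]
  have hsucc0 : ∀ ν n, 𝒜.val q (power N c (n + 1)) ν x =
      (𝒜.wordSubst r w x).natEval (𝒜.val q (power N c n) ν) := fun ν n => by rw [hsucc]; rfl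
  -- Registers into which nothing flows are reset to constants.
  have hreset : ∀ z, (∀ y, ¬𝒜.Flows r w y z) → ∀ ν,
      𝒜.val q w ν z = 𝒜.val q w 0 z ∧ 𝒜.val r w ν z = 𝒜.val r w 0 z := by
    intro z hz ν
    refine ⟨natEval_congr _ fun y hy => ?_, natEval_congr _ fun y hy => (hz y hy).elim⟩
    obtain ⟨u, -, hu⟩ := (hidem' y z).1 hy
    exact (hz u hu).elim
  by_cases hx : ∀ y, ¬𝒜.Flows r w y x
  · refine ⟨𝒜.val q w 0 x + 𝒜.val r w 0 x, fun ν n => ?_, Or.inr fun ν n => ?_⟩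
    · rw [hw0, (hreset x hx ν).1]
      omega
    · cases n with
      | zero => omega
      | succ n =>
        rw [hsucc, (hreset x hx _).2]
        omega
  · push Not at hx
    obtain ⟨z₀, hz₀⟩ := hx
    have hxx := hself hz₀
    have hother : ∀ z, 𝒜.Flows r w z x → z ≠ x → ∀ y, ¬𝒜.Flows r w y z := fun z hz hne y hy =>
      hne (huniq (hself hy) hz)
    have hmono : ∀ ν n, 𝒜.val q (power N c n) ν x ≤ 𝒜.val q (power N c (n + 1)) ν x := by
      intro ν n
      rw [hsucc]
      exact hxx.le_val _
    have hmono' : ∀ ν, Monotone fun n => 𝒜.val q (power N c n) ν x := fun ν =>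
      monotone_nat_of_le_succ (hmono ν)
    have hcop : (𝒜.wordSubst r w x).Copyless := (h𝒜.wordSubst r w).1 x
    obtain ⟨A₀, B₀, h₀⟩ := hcop.exists_natEval_update hxx (𝒜.val q w 0)
    obtain ⟨A₁, B₁, h₁⟩ := hcop.exists_natEval_update hxx (𝒜.val r w 0)
    have hstep₀ : ∀ ν, 𝒜.val q (power N c 1) ν x = max (A₀ + 𝒜.val q (power N c 0) ν x) B₀ := by
      intro ν
      rw [hsucc0, ← h₀]
      refine natEval_congr _ fun z hz => ?_
      by_cases hzx : z = x
      · subst hzx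
        rw [Function.update_self]
      · rw [Function.update_of_ne hzx, hw0, (hreset z (hother z hz hzx) ν).1]
    have hstep₁ : ∀ ν n, 𝒜.val q (power N c (n + 2)) ν x =
        max (A₁ + 𝒜.val q (power N c (n + 1)) ν x) B₁ := by
      intro ν n
      rw [hsucc0, ← h₁]
      refine natEval_congr _ fun z hz => ?_
      by_cases hzx : z = x
      · subst hzx
        rw [Function.update_self]
      · rw [Function.update_of_ne hzx, hsucc, (hreset z (hother z hz hzx) _).2]
    rcases Nat.eq_zero_or_pos A₁ with hA | hA
    · refine ⟨A₀ + B₀ + B₁, fun ν n => ?_, Or.inr fun ν n => ?_⟩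
      · have := hmono' ν (Nat.zero_le n)
        dsimp only at this
        omega
      · have hb : ∀ n, 𝒜.val q (power N c (n + 1)) ν x ≤
            max (𝒜.val q (power N c 1) ν x) B₁ := by
          intro n
          induction n with
          | zero => exact le_max_left _ _
          | succ n ih =>
            rw [hstep₁]
            omega
        have hs := hstep₀ ν
        cases n with
        | zero => omega
        | succ n =>
          have := hb n
          omega
    · refine ⟨1, fun ν n => ?_, Or.inl fun ν n => ?_⟩
      · have := hmono' ν (Nat.zero_le n)
        dsimp only at this
        omega
      · cases n with
        | zero => omega
        | succ n =>
          induction n with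
          | zero => omega
          | succ n ih =>
            rw [hstep₁]
            omega

end Growth

end CRA

namespace CRA

open SRExpr

section Growth

variable {A Q X : Type*} {𝒜 : CRA ℕ A Q X}

/-- The register `x` grows linearly along the powers of `c` read from the state `q`. -/
def Grows (𝒜 : CRA ℕ A Q X) (N : ℕ) (q : Q) (c : A) (x : X) : Prop :=
  ∃ C, ∀ ν n, n ≤ 𝒜.val q (power N c n) ν x + C

/-- A uniform version, with the constant `C`, of the alternative of `IsStable.growth_dichotomy`. -/
structure IsGrowthBound (𝒜 : CRA ℕ A Q X) (N C : ℕ) : Prop where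
  le_val : ∀ q c ν n x, 𝒜.val q (power N c 0) ν x ≤ 𝒜.val q (power N c n) ν x + C
  le_of_grows : ∀ {q c x}, 𝒜.Grows N q c x → ∀ ν n, n ≤ 𝒜.val q (power N c n) ν x + C
  val_le : ∀ {q c x}, ¬𝒜.Grows N q c x → ∀ ν n,
    𝒜.val q (power N c n) ν x ≤ 𝒜.val q (power N c 0) ν x + C

theorem IsStable.exists_isGrowthBound [Finite A] [Finite Q] [Finite X] {N : ℕ}
    (hN : 𝒜.IsStable N) (h𝒜 : 𝒜.Copyless) : ∃ C, 𝒜.IsGrowthBound N C := by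
  choose f hf using fun p : Q × A × X => hN.growth_dichotomy h𝒜 p.1 p.2.1 p.2.2
  obtain ⟨C, hC⟩ := (Set.finite_range f).bddAbove
  have hC : ∀ q c x, f (q, c, x) ≤ C := fun q c x => hC ⟨(q, c, x), rfl⟩
  refine ⟨C, fun q c ν n x => ?_, fun {q c x} hg ν n => ?_, fun {q c x} hg ν n => ?_⟩
  · exact ((hf (q, c, x)).1 ν n).trans (by have := hC q c x; dsimp only; omega)
  · rcases (hf (q, c, x)).2 with h | h
    · exact (h ν n).trans (by have := hC q c x; dsimp only; omega)
    · -- A bounded register cannot grow: compare the two bounds at a large exponent.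
      obtain ⟨D, hD⟩ := hg
      have h1 := hD 0 (𝒜.val q (power N c 0) 0 x + f (q, c, x) + D + 1)
      have h2 := h 0 (𝒜.val q (power N c 0) 0 x + f (q, c, x) + D + 1)
      dsimp only at h2
      omega
  · rcases (hf (q, c, x)).2 with h | h
    · exact (hg ⟨_, h⟩).elim
    · exact (h ν n).trans (by have := hC q c x; dsimp only; omega)

variable {N C : ℕ} {q : Q} {c : A}

theorem IsGrowthBound.le_val_append (hC : 𝒜.IsGrowthBound N C) {v : List A} {ν : X → ℕ} {n : ℕ}
    {x y : X} (hy : 𝒜.Grows N q c y) (hyx : 𝒜.Flows (𝒜.stateAfter q (power N c n)) v y x) :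
    n ≤ 𝒜.val q (power N c n ++ v) ν x + C := by
  rw [val_append]
  have h1 := hC.le_of_grows hy ν n
  have h2 := hyx.le_val (𝒜.val q (power N c n) ν)
  omega

variable [Fintype X]

theorem IsGrowthBound.val_append_le (hC : 𝒜.IsGrowthBound N C) (hN : 𝒜.IsStable N)
    (h𝒜 : 𝒜.Copyless) (v : List A) (ν : X → ℕ) (n : ℕ) (x : X) :
    𝒜.val q (power N c 0 ++ v) ν x ≤ 𝒜.val q (power N c n ++ v) ν x + Fintype.card X * C := by
  rw [val_append, val_append, stateAfter_eq_of_flowMap_eq (hN.flowMap_power_eq c 0 n)]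
  exact ((h𝒜.wordSubst _ _).1 x).natEval_le_add fun y _ => hC.le_val q c ν n y

theorem IsGrowthBound.val_append_le_of_not_grows (hC : 𝒜.IsGrowthBound N C) (hN : 𝒜.IsStable N)
    (h𝒜 : 𝒜.Copyless) {v : List A} {ν : X → ℕ} {n : ℕ} {x : X}
    (h : ∀ y, 𝒜.Grows N q c y → ¬𝒜.Flows (𝒜.stateAfter q (power N c n)) v y x) :
    𝒜.val q (power N c n ++ v) ν x ≤ 𝒜.val q (power N c 0 ++ v) ν x + Fintype.card X * C := by
  rw [val_append, val_append, stateAfter_eq_of_flowMap_eq (hN.flowMap_power_eq c 0 n)]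
  exact ((h𝒜.wordSubst _ _).1 x).natEval_le_add fun y hy =>
    hC.val_le (fun hg => h y hg hy) ν n

/-- If the exponent of a power contributes substantially to the output, then it does so through a
tight register that grows along that power. -/
theorem IsGrowthBound.exists_tight [DecidableEq X] (hC : 𝒜.IsGrowthBound N C)
    (hN : 𝒜.IsStable N) (h𝒜 : 𝒜.Copyless) {v : List A} {ν : X → ℕ} {n : ℕ}
    (h : (𝒜.outExpr q (power N c 0 ++ v)).natEval ν + Fintype.card X * C <
      (𝒜.outExpr q (power N c n ++ v)).natEval ν) :
    ∃ y, 𝒜.Grows N q c y ∧ (𝒜.outExpr (𝒜.stateAfter q (power N c n)) v).Tight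
      (𝒜.val q (power N c n) ν) y := by
  rw [natEval_outExpr_append, natEval_outExpr_append,
    stateAfter_eq_of_flowMap_eq (hN.flowMap_power_eq c 0 n)] at h
  obtain ⟨s, d, -, hv, hl⟩ := (h𝒜.outExpr (𝒜.stateAfter q (power N c n)) v).exists_monomial
    (𝒜.val q (power N c n) ν)
  by_contra hno
  push Not at hno
  have hb : ∑ x ∈ s, 𝒜.val q (power N c n) ν x ≤
      ∑ x ∈ s, (𝒜.val q (power N c 0) ν x + C) :=
    Finset.sum_le_sum fun x hx => hC.val_le (fun hg => hno x hg (tight_of_mem_monomial hv hl hx)) ν n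
  rw [Finset.sum_add_distrib, Finset.sum_const, smul_eq_mul] at hb
  have hs := Nat.mul_le_mul_right C (Finset.card_le_univ s)
  have := hl (𝒜.val q (power N c 0) ν)
  omega

end Growth

end CRA

/-! ### A selection principle -/

/-- Among sufficiently many natural numbers there are `r` such that the colour of a pair `s < l`
can be chosen to depend on `s` only. -/
theorem exists_end_homogeneous (X : Type*) [Finite X] (r : ℕ) :
    ∃ M, ∀ (_ : Nonempty X) (R : ℕ → ℕ → X → Prop) (s : Finset ℕ), M ≤ s.card →
      (∀ i ∈ s, ∀ j ∈ s, i < j → ∃ x, R i j x) →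
      ∃ B ⊆ s, B.card = r ∧ ∃ γ : ℕ → X, ∀ i ∈ B, ∀ j ∈ B, i < j → R i j (γ i) := by
  classical
  have := Fintype.ofFinite X
  induction r with
  | zero =>
    exact ⟨0, fun ⟨x⟩ R s _ _ => ⟨∅, by simp, rfl, fun _ => x, by simp⟩⟩
  | succ r ih =>
    obtain ⟨M, hM⟩ := ih
    refine ⟨Fintype.card X * M + 1, fun hX R s hs hR => ?_⟩
    have hne : s.Nonempty := Finset.card_pos.1 (by omega)
    set i := s.min' hne with hi
    have his : i ∈ s := s.min'_mem hne
    have hlt : ∀ j ∈ s.erase i, i < j := fun j hj =>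
      lt_of_le_of_ne (s.min'_le j (Finset.mem_of_mem_erase hj)) (Finset.ne_of_mem_erase hj).symm
    choose! f hf using fun j (hj : j ∈ s.erase i) =>
      hR i his j (Finset.mem_of_mem_erase hj) (hlt j hj)
    obtain ⟨x, -, hx⟩ := Finset.exists_le_card_fiber_of_mul_le_card_of_maps_to
      (s := s.erase i) (t := Finset.univ) (f := f) (n := M) (fun _ _ => Finset.mem_univ _)
      Finset.univ_nonempty (by
        rw [Finset.card_erase_of_mem his, Finset.card_univ]
        omega)
    have hsub : (s.erase i).filter (fun j => f j = x) ⊆ s.erase i := Finset.filter_subset _ _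
    obtain ⟨B, hB, hcard, γ, hγ⟩ := hM hX R _ hx fun j hj k hk hjk =>
      hR j (Finset.mem_of_mem_erase (hsub hj)) k (Finset.mem_of_mem_erase (hsub hk)) hjk
    have hiB : i ∉ B := fun h => Finset.notMem_erase i s (hsub (hB h))
    refine ⟨insert i B, ?_, ?_, Function.update γ i x, ?_⟩
    · exact Finset.insert_subset his fun j hj => Finset.mem_of_mem_erase (hsub (hB hj))
    · rw [Finset.card_insert_of_notMem hiB, hcard]
    · intro j hj k hk hjk
      rcases Finset.mem_insert.1 hj with rfl | hj
      · rcases Finset.mem_insert.1 hk with rfl | hk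
        · exact (lt_irrefl _ hjk).elim
        · rw [Function.update_self, ← (Finset.mem_filter.1 (hB hk)).2]
          exact hf k (hsub (hB hk))
      · rw [Function.update_of_ne (by rintro rfl; exact hiB hj)]
        rcases Finset.mem_insert.1 hk with rfl | hk
        · exact (lt_asymm hjk (hlt j (hsub (hB hj)))).elim
        · exact hγ j hj k hk hjk

/-! ### The test words -/

/-- One letter of the evaluation of `ℬ` on the reverse of a word: the registers `(x, y)`. -/
def scanStep : Letter → ℕ × ℕ → ℕ × ℕ
  | .a, p => (p.1 + 1, p.2)
  | .b, p => (p.1, p.2 + 1)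
  | .hash, p => (max p.1 p.2, 0)

/-- The function `f_ℬ^R` with values in `ℕ`. -/
def scanMax (w : List Letter) : ℕ :=
  max (w.foldr scanStep (0, 0)).1 (w.foldr scanStep (0, 0)).2

theorem foldr_scanStep_replicate_a (n : ℕ) (p : ℕ × ℕ) :
    (List.replicate n Letter.a).foldr scanStep p = (p.1 + n, p.2) := by
  induction n with
  | zero => rfl
  | succ n ih =>
    rw [List.replicate_succ, List.foldr_cons, ih]
    rfl

theorem foldr_scanStep_replicate_b (n : ℕ) (p : ℕ × ℕ) :
    (List.replicate n Letter.b).foldr scanStep p = (p.1, p.2 + n) := by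
  induction n with
  | zero => rfl
  | succ n ih =>
    rw [List.replicate_succ, List.foldr_cons, ih]
    rfl

open CRA (power)

/-- The concatenation of the blocks `b ^ (N * (m k + 1)) a ^ (N * (n k + 1)) #` for `i ≤ k < j`. -/
def testSegment (N : ℕ) (n m : ℕ → ℕ) (i j : ℕ) : List Letter :=
  (List.Ico i j).flatMap fun k =>
    power N Letter.b (m k) ++ power N Letter.a (n k) ++ [Letter.hash]

section Segment

variable {N : ℕ} {n m : ℕ → ℕ}

theorem testSegment_append {i j k : ℕ} (hij : i ≤ j) (hjk : j ≤ k) :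
    testSegment N n m i j ++ testSegment N n m j k = testSegment N n m i k := by
  rw [testSegment, testSegment, testSegment, ← List.flatMap_append, List.Ico.append_consecutive hij hjk]

theorem testSegment_succ (i : ℕ) : testSegment N n m i (i + 1) =
    power N Letter.b (m i) ++ power N Letter.a (n i) ++ [Letter.hash] := by
  rw [testSegment, List.Ico.succ_singleton, List.flatMap_singleton]

theorem testSegment_self (i : ℕ) : testSegment N n m i i = [] := by
  rw [testSegment, List.Ico.self_empty, List.flatMap_nil]

theorem testSegment_eq_cons {i j : ℕ} (hij : i < j) : testSegment N n m i j =
    power N Letter.b (m i) ++ power N Letter.a (n i) ++ [Letter.hash] ++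
      testSegment N n m (i + 1) j := by
  rw [← testSegment_append (Nat.le_succ i) hij, testSegment_succ]

/-- The decomposition of a test word around the block of index `i`. -/
theorem testSegment_eq_around {i j : ℕ} (hij : i < j) : testSegment N n m 0 j =
    testSegment N n m 0 i ++ power N Letter.b (m i) ++ power N Letter.a (n i) ++
      ([Letter.hash] ++ testSegment N n m (i + 1) j) := by
  rw [← testSegment_append (Nat.zero_le i) hij.le, testSegment_eq_cons hij]
  simp only [List.append_assoc]

theorem testSegment_congr {n' m' : ℕ → ℕ} {i j : ℕ} (h : ∀ k, i ≤ k → k < j → n k = n' k)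
    (h' : ∀ k, i ≤ k → k < j → m k = m' k) : testSegment N n m i j = testSegment N n' m' i j := by
  refine List.flatMap_congr fun k hk => ?_
  rw [List.Ico.mem] at hk
  rw [h k hk.1 hk.2, h' k hk.1 hk.2]

theorem testSegment_update_a {i j l k : ℕ} (h : j ≤ l ∨ l < i) :
    testSegment N (Function.update n l k) m i j = testSegment N n m i j :=
  testSegment_congr (fun _ _ _ => Function.update_of_ne (by omega) _ _) fun _ _ _ => rfl

theorem testSegment_update_b {i j l k : ℕ} (h : j ≤ l ∨ l < i) :
    testSegment N n (Function.update m l k) i j = testSegment N n m i j :=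
  testSegment_congr (fun _ _ _ => rfl) fun _ _ _ => Function.update_of_ne (by omega) _ _

theorem exists_testSegment_eq_append_hash {K : ℕ} (hK : 0 < K) :
    ∃ w, testSegment N n m 0 K = w ++ [Letter.hash] := by
  obtain ⟨K, rfl⟩ := Nat.exists_eq_succ_of_ne_zero hK.ne'
  rw [← testSegment_append (Nat.zero_le K) (Nat.le_succ K), testSegment_succ, ← List.append_assoc]
  exact ⟨_, rfl⟩

theorem scanMax_testSegment {i j : ℕ} (hij : i < j) : scanMax (testSegment N n m i j) =
    max (scanMax (testSegment N n m (i + 1) j) + N * (n i + 1)) (N * (m i + 1)) := by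
  rw [testSegment_eq_cons hij]
  simp only [scanMax, List.foldr_append, foldr_scanStep_replicate_a, foldr_scanStep_replicate_b,
    List.foldr_cons, List.foldr_nil, scanStep, Nat.zero_add]

/-- An upper bound for `f_ℬ^R` on a test word, from an upper bound `c` for the partial sums of the
numbers of `a`'s. -/
theorem scanMax_testSegment_le {c : ℕ → ℕ} {B K : ℕ} (hc : ∀ k < K, c k + n k + 1 ≤ c (k + 1))
    (hm : ∀ k < K, c k + m k + 1 ≤ B) (hK : c K ≤ B) :
    N * c 0 + scanMax (testSegment N n m 0 K) ≤ N * B := by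
  suffices h : ∀ i ≤ K, N * c i + scanMax (testSegment N n m i K) ≤ N * B from h 0 (Nat.zero_le K)
  intro i hi
  induction hi using Nat.decreasingInduction with
  | self =>
    rw [testSegment_self]
    exact Nat.mul_le_mul_left N hK
  | of_succ i hi ih =>
    rw [scanMax_testSegment hi]
    have h1 := Nat.mul_le_mul_left N (hc i hi)
    have h2 := Nat.mul_le_mul_left N (hm i hi)
    simp only [Nat.mul_add, mul_one] at h1 h2 ⊢
    omega

theorem le_scanMax_testSegment {c : ℕ → ℕ} {j K : ℕ} (hc : ∀ k < j, c (k + 1) ≤ c k + n k + 1)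
    (hj : j < K) : N * (c j + m j + 1) ≤ N * c 0 + scanMax (testSegment N n m 0 K) := by
  suffices h : ∀ i ≤ j, N * (c j + m j + 1) ≤ N * c i + scanMax (testSegment N n m i K) from
    h 0 (Nat.zero_le j)
  intro i hi
  induction hi using Nat.decreasingInduction with
  | self =>
    rw [scanMax_testSegment hj]
    simp only [Nat.mul_add, mul_one]
    omega
  | of_succ i hi ih =>
    rw [scanMax_testSegment (hi.trans hj)]
    have h1 := Nat.mul_le_mul_left N (hc i hi)
    simp only [Nat.mul_add, mul_one] at h1 ih ⊢
    omega

end Segment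

/-- Exponents of `a` in the test word of index `l`: large before the block of index `l`. -/
def expA (t l k : ℕ) : ℕ := if k < l then t else 0

/-- Exponents of `b` in the test word of index `l`: very large in the block of index `l` only. -/
def expB (z l k : ℕ) : ℕ := if k = l then z else 0

section Values

variable {N t z l s K : ℕ}

theorem le_scanMax_test (hl : l < K) :
    N * (l * t + l + z + 1) ≤ scanMax (testSegment N (expA t l) (expB z l) 0 K) := by
  have h := le_scanMax_testSegment (N := N) (n := expA t l) (m := expB z l) (c := fun k => k * t + k)
    (fun k hk => by
      simp only [expA, if_pos hk, Nat.succ_mul]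
      omega) hl
  simp only [expB, if_true, zero_mul, Nat.add_zero, mul_zero, Nat.zero_add] at h
  exact h

theorem scanMax_test_update_a_le (hl : l < K) {D : ℕ} (hD : D + K ≤ z) :
    scanMax (testSegment N (Function.update (expA t l) l D) (expB z l) 0 K) ≤
      N * (l * t + l + z + 1) := by
  have h := scanMax_testSegment_le (N := N) (n := Function.update (expA t l) l D) (m := expB z l)
    (c := fun k => if k ≤ l then k * t + k else l * t + D + k) (B := l * t + l + z + 1) (K := K)
    (fun k hk => by
      rcases lt_trichotomy k l with h | rfl | h
      · simp only [expA, Function.update_of_ne h.ne, if_pos h, if_pos h.le, Nat.succ_mul,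
          if_pos (Nat.succ_le_of_lt h)]
        omega
      · simp
        omega
      · simp only [expA, Function.update_of_ne h.ne', if_neg h.not_gt, if_neg h.not_ge,
          if_neg (show ¬k + 1 ≤ l by omega)]
        omega)
    (fun k hk => by
      rcases lt_trichotomy k l with h | rfl | h
      · have := Nat.mul_le_mul_right t h.le
        simp only [expB, if_pos h.le, if_neg h.ne]
        omega
      · simp [expB]
      · simp only [expB, if_neg h.not_ge, if_neg h.ne']
        omega)
    (by
      simp only [if_neg hl.not_ge]
      omega)
  simpa using h

theorem scanMax_test_update_b_le (hl : l < K) (hs : s < l) (hz : K ≤ z) :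
    scanMax (testSegment N (expA t l) (Function.update (expB z l) s z) 0 K) ≤
      N * (l * t + l + z + 1) := by
  have h := scanMax_testSegment_le (N := N) (n := expA t l) (m := Function.update (expB z l) s z)
    (c := fun k => if k ≤ l then k * t + k else l * t + k) (B := l * t + l + z + 1) (K := K)
    (fun k hk => by
      rcases lt_trichotomy k l with h | rfl | h
      · simp only [expA, if_pos h, if_pos h.le, Nat.succ_mul,
          if_pos (Nat.succ_le_of_lt h)]
        omega
      · simp [expA]
      · simp only [expA, if_neg h.not_gt, if_neg h.not_ge, if_neg (show ¬k + 1 ≤ l by omega)]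
        omega)
    (fun k hk => by
      have hz' : Function.update (expB z l) s z k ≤ z := by
        by_cases hks : k = s
        · simp [hks]
        · rw [Function.update_of_ne hks, expB]
          split <;> omega
      rcases le_or_gt k l with h | h
      · have := Nat.mul_le_mul_right t h
        simp only [if_pos h]
        omega
      · rw [Function.update_of_ne (by omega)]
        simp only [expB, if_neg h.not_ge, if_neg h.ne']
        omega)
    (by
      simp only [if_neg hl.not_ge]
      omega)
  simpa using h

theorem scanMax_test_update_zero_le (hl : l < K) (hs : s < l) (hz : K ≤ z) :
    N * t + scanMax (testSegment N (Function.update (expA t l) s 0) (expB z l) 0 K) ≤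
      N * (l * t + l + z + 1) := by
  -- The partial sums are shifted by `t` up to the index `s`.
  have h := scanMax_testSegment_le (N := N) (n := Function.update (expA t l) s 0) (m := expB z l)
    (c := fun k => if k ≤ s then (k + 1) * t + k else if k ≤ l then k * t + k else l * t + k)
    (B := l * t + l + z + 1) (K := K)
    (fun k hk => by
      rcases lt_trichotomy k s with h | rfl | h
      · simp only [expA, Function.update_of_ne h.ne, if_pos (h.trans hs), if_pos h.le,
          if_pos (Nat.succ_le_of_lt h), Nat.succ_mul]
        omega
      · simp only [Function.update_self, le_refl, if_true, Nat.succ_mul,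
          if_neg (show ¬k + 1 ≤ k by omega), if_pos (Nat.succ_le_of_lt hs)]
        omega
      · rw [Function.update_of_ne h.ne']
        simp only [expA, if_neg h.not_ge, if_neg (show ¬k + 1 ≤ s by omega)]
        rcases lt_trichotomy k l with h | rfl | h
        · simp only [if_pos h, if_pos h.le, Nat.succ_mul, if_pos (Nat.succ_le_of_lt h)]
          omega
        · simp
        · simp only [if_neg h.not_gt, if_neg h.not_ge, if_neg (show ¬k + 1 ≤ l by omega)]
          omega)
    (fun k hk => by
      rcases le_or_gt k s with h | h
      · have := Nat.mul_le_mul_right t (show k + 1 ≤ l by omega)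
        simp only [expB, if_pos h, if_neg (show k ≠ l by omega)]
        omega
      · simp only [expB, if_neg h.not_ge]
        rcases lt_trichotomy k l with h | rfl | h
        · have := Nat.mul_le_mul_right t h.le
          simp only [if_neg h.ne, if_pos h.le]
          omega
        · simp
        · simp only [if_neg h.ne', if_neg h.not_ge]
          omega)
    (by
      simp only [if_neg hl.not_ge, if_neg (hs.trans hl).not_ge]
      omega)
  simpa using h

end Values

open SRExpr

/-! ### Tight registers on the test words -/

namespace CRA

variable {Q X : Type*} {𝒜 : CRA ℕ Letter Q X} {N C K l r : ℕ}

/-- The part of a test word before the `a`'s of the block of index `s`. -/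
def headSegment (N : ℕ) (n m : ℕ → ℕ) (s : ℕ) : List Letter :=
  testSegment N n m 0 s ++ power N Letter.b (m s)

/-- The part of a test word after the `a`'s of the block of index `s` and before the block of
index `r`. -/
def tailSegment (N : ℕ) (n m : ℕ → ℕ) (s r : ℕ) : List Letter :=
  [Letter.hash] ++ testSegment N n m (s + 1) r

theorem testSegment_eq_head_append_tail {n m : ℕ → ℕ} {s r : ℕ} (h : s < r) :
    testSegment N n m 0 r =
      headSegment N n m s ++ power N Letter.a (n s) ++ tailSegment N n m s r :=
  testSegment_eq_around h

theorem tailSegment_append {n m : ℕ → ℕ} {s r j : ℕ} (hs : s < r) (hr : r ≤ j) :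
    tailSegment N n m s r ++ testSegment N n m r j = tailSegment N n m s j := by
  rw [tailSegment, tailSegment, List.append_assoc, testSegment_append hs hr]

theorem IsStable.flowMap_testSegment (hN : 𝒜.IsStable N) (n m n' m' : ℕ → ℕ) (i j : ℕ) :
    𝒜.flowMap (testSegment N n m i j) = 𝒜.flowMap (testSegment N n' m' i j) := by
  unfold testSegment
  induction List.Ico i j with
  | nil => rfl
  | cons k l ih =>
    simp only [List.flatMap_cons, flowMap_append]
    rw [ih, hN.flowMap_power_eq _ (n k) (n' k), hN.flowMap_power_eq _ (m k) (m' k)]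

theorem IsStable.flowMap_headSegment (hN : 𝒜.IsStable N) (n m n' m' : ℕ → ℕ) (s : ℕ) :
    𝒜.flowMap (headSegment N n m s) = 𝒜.flowMap (headSegment N n' m' s) := by
  rw [headSegment, headSegment, flowMap_append, flowMap_append,
    hN.flowMap_testSegment n m n' m', hN.flowMap_power_eq _ (m s) (m' s)]

theorem IsStable.flowMap_tailSegment (hN : 𝒜.IsStable N) (n m n' m' : ℕ → ℕ) (s r : ℕ) :
    𝒜.flowMap (tailSegment N n m s r) = 𝒜.flowMap (tailSegment N n' m' s r) := by
  rw [tailSegment, tailSegment, flowMap_append, flowMap_append,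
    hN.flowMap_testSegment n m n' m']

/-- The state before the `a`'s of the block of index `s` of a test word; for a stable exponent, it
does not depend on the exponents of the test word. -/
def headState (𝒜 : CRA ℕ Letter Q X) (N s : ℕ) : Q :=
  𝒜.stateAfter 𝒜.q₀ (headSegment N 0 0 s)

/-- The register `y` after the `a`'s of the block of index `s` flows to the register `x` before
the block of index `r`. -/
def TailFlows (𝒜 : CRA ℕ Letter Q X) (N s r : ℕ) (y x : X) : Prop :=
  𝒜.Flows (𝒜.stateAfter (𝒜.headState N s) (power N Letter.a 0)) (tailSegment N 0 0 s r) y x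

theorem Copyless.eq_of_tailFlows (h𝒜 : 𝒜.Copyless) {s r : ℕ} {y x x' : X}
    (h : 𝒜.TailFlows N s r y x) (h' : 𝒜.TailFlows N s r y x') : x = x' :=
  (h𝒜.wordSubst _ _).eq_of_mem h h'

theorem IsStable.stateAfter_headSegment (hN : 𝒜.IsStable N) (n m : ℕ → ℕ) (s : ℕ) :
    𝒜.stateAfter 𝒜.q₀ (headSegment N n m s) = 𝒜.headState N s :=
  stateAfter_eq_of_flowMap_eq (hN.flowMap_headSegment _ _ _ _ _) _

theorem IsStable.flows_iff_tailFlows (hN : 𝒜.IsStable N) (n m : ℕ → ℕ) (k : ℕ) {s r : ℕ}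
    {y x : X} : 𝒜.Flows (𝒜.stateAfter (𝒜.headState N s) (power N Letter.a k))
      (tailSegment N n m s r) y x ↔ 𝒜.TailFlows N s r y x := by
  rw [TailFlows, flows_iff_of_flowMap_eq (hN.flowMap_tailSegment n m 0 0 s r),
    stateAfter_eq_of_flowMap_eq (hN.flowMap_power_eq _ k 0)]

/-- The register `x` is tight, for the output on a test word with `K` blocks, before the block of
index `r`. -/
def TightAt [DecidableEq X] (𝒜 : CRA ℕ Letter Q X) (N K : ℕ) (n m : ℕ → ℕ) (r : ℕ) (x : X) :
    Prop :=
  (𝒜.outExpr (𝒜.stateAfter 𝒜.q₀ (testSegment N n m 0 r)) (testSegment N n m r K)).Tight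
    (𝒜.val 𝒜.q₀ (testSegment N n m 0 r) 𝒜.ν₀) x

/-- The automaton outputs `f_ℬ^R` on the test words with `K` blocks. -/
def OutputsScanMax (𝒜 : CRA ℕ Letter Q X) (N K : ℕ) : Prop :=
  ∀ n m, (𝒜.outExpr 𝒜.q₀ (testSegment N n m 0 K)).natEval 𝒜.ν₀ = scanMax (testSegment N n m 0 K)

theorem val_testSegment_update_a (hN : 𝒜.IsStable N) (n m : ℕ → ℕ) (hl : l < r) (k : ℕ) :
    𝒜.val 𝒜.q₀ (testSegment N (Function.update n l k) m 0 r) 𝒜.ν₀ =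
      𝒜.val (𝒜.headState N l) (power N Letter.a k ++ tailSegment N n m l r)
        (𝒜.val 𝒜.q₀ (headSegment N n m l) 𝒜.ν₀) := by
  rw [← hN.stateAfter_headSegment n m, ← val_append, testSegment_eq_head_append_tail hl,
    Function.update_self, List.append_assoc, headSegment, headSegment, tailSegment, tailSegment,
    testSegment_update_a (.inl le_rfl), testSegment_update_a (.inr l.lt_succ_self)]

theorem val_testSegment_update_b (hN : 𝒜.IsStable N) (n m : ℕ → ℕ) (hl : l < r) (k : ℕ) :
    𝒜.val 𝒜.q₀ (testSegment N n (Function.update m l k) 0 r) 𝒜.ν₀ =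
      𝒜.val (𝒜.stateAfter 𝒜.q₀ (testSegment N 0 0 0 l))
        (power N Letter.b k ++ (power N Letter.a (n l) ++ tailSegment N n m l r))
        (𝒜.val 𝒜.q₀ (testSegment N n m 0 l) 𝒜.ν₀) := by
  rw [stateAfter_eq_of_flowMap_eq (hN.flowMap_testSegment 0 0 n m 0 l), ← val_append,
    testSegment_eq_around hl, Function.update_self, List.append_assoc, List.append_assoc,
    tailSegment, testSegment_update_b (.inl le_rfl), testSegment_update_b (.inr l.lt_succ_self)]

variable [Fintype X] [DecidableEq X] {t z s : ℕ}

/-- In the test word of index `l` the `a`'s of an earlier block contribute to the output, hence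
they are counted by a register that remains tight until the end. -/
theorem IsGrowthBound.exists_tightAt (hC : 𝒜.IsGrowthBound N C) (hN : 𝒜.IsStable N)
    (h𝒜 : 𝒜.Copyless) (hout : 𝒜.OutputsScanMax N K) (ht : Fintype.card X * C < t) (hz : K ≤ z)
    (hs : s < l) (hl : l < K) :
    ∃ y, 𝒜.Grows N (𝒜.headState N s) Letter.a y ∧ ∀ r, s < r → r ≤ K →
      ∃ x, 𝒜.TailFlows N s r y x ∧ 𝒜.TightAt N K (expA t l) (expB z l) r x := by
  set n := expA t l with hn
  set m := expB z l with hm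
  have hsK : s < K := hs.trans hl
  have hns : n s = t := if_pos hs
  have hdec : ∀ k, testSegment N (Function.update n s k) m 0 K =
      headSegment N n m s ++ (power N Letter.a k ++ tailSegment N n m s K) := by
    intro k
    rw [testSegment_eq_head_append_tail hsK, Function.update_self, List.append_assoc, headSegment,
      headSegment, tailSegment, tailSegment, testSegment_update_a (.inl le_rfl),
      testSegment_update_a (.inr s.lt_succ_self)]
  have hval : ∀ k, (𝒜.outExpr (𝒜.headState N s)
      (power N Letter.a k ++ tailSegment N n m s K)).natEval
        (𝒜.val 𝒜.q₀ (headSegment N n m s) 𝒜.ν₀) =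
      scanMax (testSegment N (Function.update n s k) m 0 K) := by
    intro k
    rw [← hout, hdec, natEval_outExpr_append 𝒜 𝒜.q₀, hN.stateAfter_headSegment]
  have h0 := scanMax_test_update_zero_le (N := N) (t := t) hl hs hz
  have h1 := le_scanMax_test (N := N) (t := t) (z := z) hl
  rw [← hn, ← hm] at h0 h1
  obtain ⟨y, hy, hty⟩ := hC.exists_tight hN h𝒜 (q := 𝒜.headState N s) (c := Letter.a)
    (v := tailSegment N n m s K) (ν := 𝒜.val 𝒜.q₀ (headSegment N n m s) 𝒜.ν₀) (n := t) (by
      rw [hval, hval, ← hns, Function.update_eq_self]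
      have := Nat.mul_le_mul_right t hN.1
      omega)
  refine ⟨y, hy, fun r hr hrK => ?_⟩
  rw [← tailSegment_append hr hrK, outExpr_append] at hty
  obtain ⟨x, hx, htx⟩ := hty.exists_of_subst (h𝒜.wordSubst _ _)
  refine ⟨x, (hN.flows_iff_tailFlows n m t).1 hx, ?_⟩
  rw [TightAt, testSegment_eq_head_append_tail hr, hns, stateAfter_append, stateAfter_append,
    val_append, val_append, stateAfter_append, hN.stateAfter_headSegment]
  exact htx

/-- Raising exponents before the block of index `r` without raising the output cannot raise a
tight register substantially. -/
theorem TightAt.val_le (hN : 𝒜.IsStable N) (h𝒜 : 𝒜.Copyless) {n m n' m' : ℕ → ℕ} {y : X}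
    (h : 𝒜.TightAt N K n m r y) (hr : r ≤ K) (hn : ∀ k, r ≤ k → n' k = n k)
    (hm : ∀ k, r ≤ k → m' k = m k)
    (hle : ∀ x, 𝒜.val 𝒜.q₀ (testSegment N n m 0 r) 𝒜.ν₀ x ≤
      𝒜.val 𝒜.q₀ (testSegment N n' m' 0 r) 𝒜.ν₀ x + C)
    (hout : (𝒜.outExpr 𝒜.q₀ (testSegment N n' m' 0 K)).natEval 𝒜.ν₀ ≤
      (𝒜.outExpr 𝒜.q₀ (testSegment N n m 0 K)).natEval 𝒜.ν₀) :
    𝒜.val 𝒜.q₀ (testSegment N n' m' 0 r) 𝒜.ν₀ y ≤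
      𝒜.val 𝒜.q₀ (testSegment N n m 0 r) 𝒜.ν₀ y + Fintype.card X * C := by
  refine Tight.le_add (h𝒜.outExpr _ _) h hle ?_
  rw [← natEval_outExpr_append, testSegment_append (Nat.zero_le r) hr,
    stateAfter_eq_of_flowMap_eq (hN.flowMap_testSegment n m n' m' 0 r),
    ← testSegment_congr (fun k hk _ => hn k hk) (fun k hk _ => hm k hk), ← natEval_outExpr_append,
    testSegment_append (Nat.zero_le r) hr]
  exact hout

end CRA

namespace CRA

variable {Q X : Type*} {𝒜 : CRA ℕ Letter Q X} {N C K l r : ℕ}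

/-- No register that counts the `a`'s of the block of index `l` is tight before the block of index
`r > l` both for the test word of index `l` and for that of index `r`. Otherwise, by the
former, it would also count the `b`'s of the block of index `l`, which is incompatible with the
latter. -/
theorem IsGrowthBound.not_tightAt [Fintype X] [DecidableEq X] {t z L : ℕ}
    (hC : 𝒜.IsGrowthBound N C) (hN : 𝒜.IsStable N) (h𝒜 : 𝒜.Copyless)
    (hout : 𝒜.OutputsScanMax N K) (hlr : l < r) (hr : r < K)
    (hL : ∀ i < K, ∀ x, 𝒜.val 𝒜.q₀ (testSegment N (expA t i) 0 0 r) 𝒜.ν₀ x ≤ L)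
    (hz : K + L + Fintype.card X * C + Fintype.card X * (Fintype.card X * C) + C < z) {x y : X}
    (hy : 𝒜.Grows N (𝒜.headState N l) Letter.a y) (hyx : 𝒜.TailFlows N l r y x)
    (hxl : 𝒜.TightAt N K (expA t l) (expB z l) r x)
    (hxr : 𝒜.TightAt N K (expA t r) (expB z r) r x) : False := by
  have hl : l < K := hlr.trans hr
  have hexpA : expA t l = Function.update (expA t l) l 0 := by simp [expA]
  have hexpB : expB z l = Function.update (0 : ℕ → ℕ) l z := by
    funext k
    simp [expB, Function.update_apply]
  -- Raising the exponent of `a` in the block of index `l` shows that `x` is large for the test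
  -- word of index `l`.
  have h1 : z - K ≤ 𝒜.val 𝒜.q₀ (testSegment N (expA t l) (expB z l) 0 r) 𝒜.ν₀ x +
      Fintype.card X * (Fintype.card X * C) + C := by
    have hle := TightAt.val_le (C := Fintype.card X * C) hN h𝒜 hxl hr.le
      (n' := Function.update (expA t l) l (z - K)) (m' := expB z l)
      (fun k hk => Function.update_of_ne (by omega) _ _) (fun _ _ => rfl) (fun u => by
        conv_lhs => rw [hexpA]
        rw [val_testSegment_update_a hN _ _ hlr, val_testSegment_update_a hN _ _ hlr]
        exact hC.val_append_le hN h𝒜 _ _ _ _) (by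
        rw [hout, hout]
        exact (scanMax_test_update_a_le hl (by omega)).trans (le_scanMax_test hl))
    have hge := hC.le_val_append (n := z - K)
      (ν := 𝒜.val 𝒜.q₀ (headSegment N (expA t l) (expB z l) l) 𝒜.ν₀) hy
      ((hN.flows_iff_tailFlows (expA t l) (expB z l) (z - K)).2 hyx)
    rw [← val_testSegment_update_a hN _ _ hlr] at hge
    omega
  -- All exponents of that test word other than the one of `b` in the block of index `l` are small,
  -- hence `x` counts these `b`'s.
  obtain ⟨u, hu, hux⟩ : ∃ u, 𝒜.Grows N (𝒜.stateAfter 𝒜.q₀ (testSegment N 0 0 0 l)) Letter.b u ∧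
      𝒜.Flows (𝒜.stateAfter (𝒜.stateAfter 𝒜.q₀ (testSegment N 0 0 0 l)) (power N Letter.b z))
        (power N Letter.a (expA t l l) ++ tailSegment N (expA t l) 0 l r) u x := by
    by_contra hno
    push Not at hno
    have hle := hC.val_append_le_of_not_grows hN h𝒜
      (ν := 𝒜.val 𝒜.q₀ (testSegment N (expA t l) 0 0 l) 𝒜.ν₀) hno
    rw [← val_testSegment_update_b hN _ _ hlr, ← val_testSegment_update_b hN _ _ hlr, ← hexpB,
      show Function.update (0 : ℕ → ℕ) l 0 = 0 from Function.update_eq_self l 0] at hle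
    have := hL l hl x
    omega
  -- Raising the exponent of these `b`'s in the test word of index `r` does not raise the output.
  have h2 := TightAt.val_le (C := Fintype.card X * C) hN h𝒜 hxr hr.le
    (n' := expA t r) (m' := Function.update (expB z r) l z)
    (fun _ _ => rfl) (fun k hk => Function.update_of_ne (by omega) _ _) (fun u => by
      conv_lhs => rw [show expB z r = Function.update (expB z r) l 0 by simp [expB, hlr.ne]]
      rw [val_testSegment_update_b hN _ _ hlr, val_testSegment_update_b hN _ _ hlr]
      exact hC.val_append_le hN h𝒜 _ _ _ _) (by
      rw [hout, hout]
      exact (scanMax_test_update_b_le hr hlr (by omega)).trans (le_scanMax_test hr))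
  have h3 := hC.le_val_append (n := z) (ν := 𝒜.val 𝒜.q₀ (testSegment N (expA t r) (expB z r) 0 l)
    𝒜.ν₀) hu (v := power N Letter.a (expA t r l) ++ tailSegment N (expA t r) (expB z r) l r)
    (x := x) (by
      refine (flows_iff_of_flowMap_eq ?_ _ _ _).1 hux
      rw [flowMap_append, flowMap_append, hN.flowMap_power_eq _ _ (expA t r l),
        hN.flowMap_tailSegment])
  rw [← val_testSegment_update_b hN _ _ hlr] at h3
  have h4 : testSegment N (expA t r) (expB z r) 0 r = testSegment N (expA t r) 0 0 r :=
    testSegment_congr (fun _ _ _ => rfl) fun k _ hk => if_neg hk.ne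
  have := hL r hr x
  rw [h4] at h2
  omega

/-- A copyless automaton over `(ℕ, max, +)` does not compute `f_ℬ^R`, not even on the words that
end with `#`. -/
theorem Copyless.not_forall_eq_scanMax [Finite Q] [Finite X] (h𝒜 : 𝒜.Copyless) :
    ¬∀ w, (𝒜.outExpr 𝒜.q₀ (w ++ [Letter.hash])).natEval 𝒜.ν₀ =
      scanMax (w ++ [Letter.hash]) := by
  classical
  intro H
  have := Fintype.ofFinite X
  have : Finite Letter := Finite.of_surjective
    (fun i : Fin 3 => match i with | 0 => Letter.a | 1 => Letter.b | 2 => Letter.hash) fun c => by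
      cases c
      exacts [⟨0, rfl⟩, ⟨1, rfl⟩, ⟨2, rfl⟩]
  obtain ⟨N, hN⟩ := 𝒜.exists_isStable
  obtain ⟨C, hC⟩ := hN.exists_isGrowthBound h𝒜
  obtain ⟨M, hM⟩ := exists_end_homogeneous X (Fintype.card X + 2)
  set K := M + 2 with hK
  have hout : 𝒜.OutputsScanMax N K := by
    intro n m
    obtain ⟨w, hw⟩ := exists_testSegment_eq_append_hash (N := N) (n := n) (m := m)
      (show 0 < K by omega)
    rw [hw, H]
  set t := Fintype.card X * C + 1 with ht
  obtain ⟨L, hL⟩ : ∃ L, ∀ r < K, ∀ i < K, ∀ x,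
      𝒜.val 𝒜.q₀ (testSegment N (expA t i) 0 0 r) 𝒜.ν₀ x ≤ L := by
    obtain ⟨L, hL⟩ := (Set.finite_range fun p : Fin K × Fin K × X =>
      𝒜.val 𝒜.q₀ (testSegment N (expA t p.2.1) 0 0 p.1) 𝒜.ν₀ p.2.2).bddAbove
    exact ⟨L, fun r hr i hi x => hL ⟨(⟨r, hr⟩, ⟨i, hi⟩, x), rfl⟩⟩
  obtain ⟨z, hz⟩ := exists_gt
    (K + L + Fintype.card X * C + Fintype.card X * (Fintype.card X * C) + C)
  have htight := fun s l (hs : s < l) (hl : l < K) =>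
    hC.exists_tightAt hN h𝒜 hout (t := t) (z := z) (by omega) (by omega) hs hl
  obtain ⟨y₀, -⟩ := htight 0 1 (by omega) (by omega)
  have : Nonempty X := ⟨y₀⟩
  obtain ⟨B, hBK, hB, γ, hγ⟩ := hM this _ (Finset.range K) (by simp [hK]) fun i _ j hj hij =>
    htight i j hij (Finset.mem_range.1 hj)
  have hBne : B.Nonempty := Finset.card_pos.1 (by omega)
  set r := B.max' hBne with hr
  have hrB : r ∈ B := B.max'_mem hBne
  have hrK : r < K := Finset.mem_range.1 (hBK hrB)
  have hlt : ∀ s ∈ B.erase r, s < r := fun s hs =>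
    lt_of_le_of_ne (B.le_max' s (Finset.mem_of_mem_erase hs)) (Finset.ne_of_mem_erase hs)
  choose! f hf hft using fun s (hs : s ∈ B.erase r) =>
    (hγ s (Finset.mem_of_mem_erase hs) r hrB (hlt s hs)).2 r (hlt s hs) hrK.le
  obtain ⟨s, hs, l, hl, hne, hfsl⟩ := Finset.exists_ne_map_eq_of_card_lt_of_maps_to
    (s := B.erase r) (t := (Finset.univ : Finset X)) (f := f) (by
      rw [Finset.card_erase_of_mem hrB, Finset.card_univ]
      omega) fun _ _ => Finset.mem_univ _
  wlog hsl : s < l generalizing s l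
  · exact this l hl s hs hne.symm hfsl.symm (by omega)
  obtain ⟨x, hx, hxt⟩ := (hγ s (Finset.mem_of_mem_erase hs) l (Finset.mem_of_mem_erase hl) hsl).2 r
    (hlt s hs) hrK.le
  obtain rfl : x = f l := (h𝒜.eq_of_tailFlows hx (hf s hs)).trans hfsl
  exact hC.not_tightAt hN h𝒜 hout (hlt l hl) hrK (hL r hrK) hz
    (hγ l (Finset.mem_of_mem_erase hl) r hrB (hlt l hl)).1 (hf l hl) hxt (hft l hl)

end CRA

/-! ### Elimination of `-∞` -/

namespace MaxPlus

theorem eq_zero_or_eq_ofNat (s : MaxPlus) : s = 0 ∨ ∃ n, s = ofNat n :=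
  WithBot.recBotCoe (C := fun s : WithBot ℕ => ofBot s = 0 ∨ ∃ n, ofBot s = ofNat n) (Or.inl rfl)
    (fun n => Or.inr ⟨n, rfl⟩) s.toBot

theorem ofNat_injective : Function.Injective ofNat := fun _ _ h => WithBot.coe_injective h

theorem ofNat_ne_zero (n : ℕ) : ofNat n ≠ 0 := fun h => WithBot.coe_ne_bot (a := n) h

/-- The element of the max-plus semiring given by a natural number or, for `none`, `-∞`. -/
def ofOption (o : Option ℕ) : MaxPlus := o.elim 0 ofNat

/-- The inverse of `ofOption`. -/
def toOption (s : MaxPlus) : Option ℕ :=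
  WithBot.recBotCoe (C := fun _ => Option ℕ) none some s.toBot

theorem ofOption_toOption (s : MaxPlus) : ofOption s.toOption = s := by
  obtain rfl | ⟨n, rfl⟩ := s.eq_zero_or_eq_ofNat <;> rfl

end MaxPlus

namespace SRExpr

variable {X : Type*}

open Classical in
/-- The valuation that agrees with `ν` on `β` and is `-∞` elsewhere. -/
noncomputable def extendBot (β : Set X) (ν : X → ℕ) (x : X) : MaxPlus :=
  if x ∈ β then MaxPlus.ofNat (ν x) else 0

open Classical in
/-- The simplification of an expression, given the set `β` of variables that are not `-∞`: an
expression over `ℕ`, or `none` if the value is `-∞`. -/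
noncomputable def finitePart (β : Set X) : SRExpr MaxPlus X → Option (SRExpr ℕ X)
  | const s => s.toOption.map const
  | var x => if x ∈ β then some (var x) else none
  | add e₁ e₂ => (finitePart β e₁).merge add (finitePart β e₂)
  | mul e₁ e₂ => Option.map₂ mul (finitePart β e₁) (finitePart β e₂)

theorem eval_extendBot (β : Set X) (ν : X → ℕ) (e : SRExpr MaxPlus X) :
    e.eval (extendBot β ν) = MaxPlus.ofOption ((e.finitePart β).map (natEval ν)) := by
  induction e with
  | const s =>
    rw [finitePart, Option.map_map]
    refine (MaxPlus.ofOption_toOption s).symm.trans ?_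
    cases s.toOption <;> rfl
  | var x =>
    simp only [eval, extendBot, finitePart]
    split <;> rfl
  | add e₁ e₂ h₁ h₂ =>
    simp only [eval, finitePart, h₁, h₂]
    cases finitePart β e₁ <;> cases finitePart β e₂
    · exact add_zero _
    · exact zero_add _
    · exact add_zero _
    · exact MaxPlus.ofNat_add _ _
  | mul e₁ e₂ h₁ h₂ =>
    simp only [eval, finitePart, h₁, h₂]
    cases finitePart β e₁ <;> cases finitePart β e₂
    · exact mul_zero _
    · exact zero_mul _
    · exact mul_zero _
    · exact MaxPlus.ofNat_mul _ _

theorem occ_finitePart_sublist (β : Set X) (e : SRExpr MaxPlus X) :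
    (((e.finitePart β).map occ).getD []).Sublist e.occ := by
  induction e with
  | const s => cases h : s.toOption <;> simp [finitePart, h, occ]
  | var x =>
    simp only [finitePart, occ]
    split <;> simp [occ]
  | add e₁ e₂ h₁ h₂ =>
    simp only [finitePart, occ]
    revert h₁ h₂
    cases finitePart β e₁ <;> cases finitePart β e₂ <;> intro h₁ h₂
    · simp
    · exact h₂.trans (List.sublist_append_right _ _)
    · exact h₁.trans (List.sublist_append_left _ _)
    · exact h₁.append h₂
  | mul e₁ e₂ h₁ h₂ =>
    simp only [finitePart, occ]
    revert h₁ h₂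
    cases finitePart β e₁ <;> cases finitePart β e₂ <;> intro h₁ h₂
    · simp
    · simp
    · simp
    · exact h₁.append h₂

/-- The simplified expression, with the dummy value `0` instead of `-∞`. -/
noncomputable def simplify (β : Set X) (e : SRExpr MaxPlus X) : SRExpr ℕ X :=
  (e.finitePart β).getD (const 0)

theorem occ_simplify_sublist (β : Set X) (e : SRExpr MaxPlus X) :
    (e.simplify β).occ.Sublist e.occ := by
  have h := occ_finitePart_sublist β e
  rw [simplify]
  revert h
  cases finitePart β e <;> exact id

theorem eval_extendBot_eq_ite (β : Set X) (ν : X → ℕ) (e : SRExpr MaxPlus X)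
    [Decidable (e.finitePart β ≠ none)] : e.eval (extendBot β ν) =
      if e.finitePart β ≠ none then MaxPlus.ofNat ((e.simplify β).natEval ν) else 0 := by
  rw [eval_extendBot, simplify]
  split_ifs with h
  · obtain ⟨e', he⟩ := Option.ne_none_iff_exists'.1 h
    rw [he]
    rfl
  · rw [not_not.1 h]
    rfl

end SRExpr

namespace CRA

variable {A Q X : Type*}

/-- The automaton over `ℕ` that simulates an automaton over the max-plus semiring. Its states also
record which registers are not `-∞`. -/
noncomputable def simplify (𝒜 : CRA MaxPlus A Q X) : CRA ℕ A (Q × Set X) X where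
  δ p c := (((𝒜.δ p.1 c).1, {x | ((𝒜.δ p.1 c).2 x).finitePart p.2 ≠ none}),
    fun x => ((𝒜.δ p.1 c).2 x).simplify p.2)
  q₀ := (𝒜.q₀, {x | 𝒜.ν₀ x ≠ 0})
  ν₀ x := (𝒜.ν₀ x).toOption.getD 0
  μ p := (𝒜.μ p.1).simplify p.2

theorem Copyless.simplify {𝒜 : CRA MaxPlus A Q X} (h𝒜 : 𝒜.Copyless) : 𝒜.simplify.Copyless := by
  refine ⟨fun p c => ⟨fun x => ?_, fun x y hxy => ?_⟩, fun p => ?_⟩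
  · exact List.Nodup.sublist (occ_simplify_sublist _ _) ((h𝒜.1 p.1 c).1 x)
  · intro z hz hz'
    exact (h𝒜.1 p.1 c).2 x y hxy ((occ_simplify_sublist _ _).subset hz)
      ((occ_simplify_sublist _ _).subset hz')
  · exact List.Nodup.sublist (occ_simplify_sublist _ _) (h𝒜.2 p.1)

theorem foldl_step_extendBot (𝒜 : CRA MaxPlus A Q X) (w : List A) (p : Q × Set X) (ν : X → ℕ) :
    w.foldl 𝒜.step (p.1, extendBot p.2 ν) =
      ((𝒜.simplify.stateAfter p w).1,
        extendBot (𝒜.simplify.stateAfter p w).2 (𝒜.simplify.val p w ν)) := by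
  classical
  induction w generalizing p ν with
  | nil => rfl
  | cons c w ih =>
    have hstep : 𝒜.step (p.1, extendBot p.2 ν) c = ((𝒜.simplify.δ p c).1.1,
        extendBot (𝒜.simplify.δ p c).1.2 fun x => ((𝒜.simplify.δ p c).2 x).natEval ν) := by
      refine Prod.ext rfl (funext fun x => ?_)
      refine (eval_extendBot_eq_ite _ _ _).trans ?_
      by_cases h : ((𝒜.δ p.1 c).2 x).finitePart p.2 ≠ none
      · exact (if_pos h).trans (if_pos (show x ∈ (𝒜.simplify.δ p c).1.2 from h)).symm
      · exact (if_neg h).trans (if_neg (show x ∉ (𝒜.simplify.δ p c).1.2 from h)).symm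
    rw [List.foldl_cons, hstep, ih, val_cons]
    rfl

theorem natEval_outExpr_simplify {𝒜 : CRA MaxPlus A Q X} {w : List A} {n : ℕ}
    (h : 𝒜.output w = MaxPlus.ofNat n) :
    (𝒜.simplify.outExpr 𝒜.simplify.q₀ w).natEval 𝒜.simplify.ν₀ = n := by
  classical
  have hν : 𝒜.ν₀ = extendBot 𝒜.simplify.q₀.2 𝒜.simplify.ν₀ := by
    funext x
    obtain hx | ⟨k, hx⟩ := (𝒜.ν₀ x).eq_zero_or_eq_ofNat
    · simp [extendBot, simplify, hx]
    · simp only [extendBot, simplify, hx, Set.mem_ofPred_eq]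
      rw [if_pos (MaxPlus.ofNat_ne_zero k)]
      rfl
  have hrun := foldl_step_extendBot 𝒜 w 𝒜.simplify.q₀ 𝒜.simplify.ν₀
  rw [← hν] at hrun
  change 𝒜.run w = _ at hrun
  rw [output, hrun, eval_extendBot_eq_ite] at h
  split at h
  · rw [outExpr, natEval_subst]
    exact MaxPlus.ofNat_injective h
  · exact (MaxPlus.ofNat_ne_zero n h.symm).elim

end CRA

theorem not_copylessComputable_of_eq_scanMax {f : List Letter → MaxPlus}
    (hf : ∀ w, f (w ++ [Letter.hash]) = MaxPlus.ofNat (scanMax (w ++ [Letter.hash]))) :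
    ¬CopylessComputable f := by
  rintro ⟨Q, X, _, _, 𝒜, h𝒜, h⟩
  exact h𝒜.simplify.not_forall_eq_scanMax fun w =>
    CRA.natEval_outExpr_simplify ((h _).trans (hf w))

/-! ### The automaton `ℬ` and the function `g` -/

instance : Finite Reg :=
  Finite.of_surjective (fun b : Bool => if b then Reg.x else Reg.y) fun r => by
    cases r
    exacts [⟨true, rfl⟩, ⟨false, rfl⟩]

theorem automatonB_copyless : automatonB.Copyless := by
  refine ⟨fun _ c => ⟨fun r => ?_, fun r r' h => ?_⟩, fun _ => ?_⟩
  · cases c <;> cases r <;> simp [automatonB, substB, Copyless, occ]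
  · cases c <;> cases r <;> cases r' <;> simp_all [automatonB, substB, occ]
  · simp [automatonB, Copyless, occ]

/-- The automaton `ℬ` with the initial value `s` of the register `x`. -/
def automatonBFrom (s : MaxPlus) : CRA MaxPlus Letter Unit Reg where
  δ := automatonB.δ
  q₀ := ()
  ν₀
    | .x => s
    | .y => MaxPlus.ofNat 0
  μ := automatonB.μ

theorem automatonBFrom_one : automatonBFrom 1 = automatonB := by
  unfold automatonBFrom automatonB
  congr 1
  funext r
  cases r <;> rfl

theorem automatonBFrom_copyless (s : MaxPlus) : (automatonBFrom s).Copyless :=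
  automatonB_copyless

theorem run_automatonBFrom_reverse_cons (s : MaxPlus) (c : Letter) (w : List Letter) :
    (automatonBFrom s).run (c :: w).reverse =
      automatonB.step ((automatonBFrom s).run w.reverse) c := by
  rw [CRA.run, CRA.run, List.reverse_cons, List.foldl_append]
  rfl

theorem blockCount_nil (c : Letter) (i : ℕ) : blockCount c [] i = 0 := by
  cases i <;> simp [blockCount]

theorem blockCount_hash_cons_zero (c : Letter) (w : List Letter) :
    blockCount c (Letter.hash :: w) 0 = 0 := by
  simp [blockCount, List.splitOn_cons_eq_if_modifyHead]

theorem blockCount_hash_cons_succ (c : Letter) (w : List Letter) (i : ℕ) :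
    blockCount c (Letter.hash :: w) (i + 1) = blockCount c w i := by
  simp [blockCount, List.splitOn_cons_eq_if_modifyHead]

theorem blockCount_cons_zero (c : Letter) {d : Letter} (hd : d ≠ Letter.hash) (w : List Letter) :
    blockCount c (d :: w) 0 = blockCount c w 0 + if d = c then 1 else 0 := by
  rw [blockCount, blockCount, List.splitOn_cons_eq_if_modifyHead, if_neg (by simpa using hd)]
  cases h : w.splitOn Letter.hash with
  | nil => exact (List.splitOn_ne_nil _ _ h).elim
  | cons u l => simp [List.count_cons]

theorem blockCount_cons_succ (c : Letter) {d : Letter} (hd : d ≠ Letter.hash) (w : List Letter)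
    (i : ℕ) : blockCount c (d :: w) (i + 1) = blockCount c w (i + 1) := by
  rw [blockCount, blockCount, List.splitOn_cons_eq_if_modifyHead, if_neg (by simpa using hd)]
  cases h : w.splitOn Letter.hash with
  | nil => rfl
  | cons u l => simp

theorem MaxPlus.ofNat_sup_range_succ (f : ℕ → ℕ) (k : ℕ) :
    MaxPlus.ofNat ((Finset.range (k + 1)).sup f) =
      ∑ j ∈ Finset.range (k + 1), MaxPlus.ofNat (f j) := by
  induction k with
  | zero => simp
  | succ k ih =>
    rw [Finset.sum_range_succ, ← ih, MaxPlus.ofNat_add, Finset.range_add_one, Finset.sup_insert,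
      max_comm]

/-- The maximum of the terms of `blockMax` of positive index, which is `-∞` if there is none. As
in all sums over the max-plus semiring, the outer sum is a maximum. -/
def tailMax (w : List Letter) : MaxPlus :=
  ∑ j ∈ Finset.range (w.count Letter.hash), MaxPlus.ofNat
    ((∑ i ∈ Finset.range (j + 1), blockCount Letter.a w i) + blockCount Letter.b w (j + 1))

theorem ofNat_blockMax (w : List Letter) :
    MaxPlus.ofNat (blockMax w) = tailMax w + MaxPlus.ofNat (blockCount Letter.b w 0) := by
  rw [blockMax, MaxPlus.ofNat_sup_range_succ, Finset.sum_range_succ']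
  simp [tailMax]

theorem tailMax_a_cons (w : List Letter) :
    tailMax (Letter.a :: w) = tailMax w * MaxPlus.ofNat 1 := by
  rw [tailMax, tailMax, Finset.sum_mul]
  refine Finset.sum_congr (by simp) fun j _ => ?_
  rw [MaxPlus.ofNat_mul, Finset.sum_range_succ', Finset.sum_range_succ']
  simp only [blockCount_cons_succ _ (show Letter.a ≠ Letter.hash by decide),
    blockCount_cons_zero _ (show Letter.a ≠ Letter.hash by decide), if_true]
  congr 1
  ring

theorem tailMax_b_cons (w : List Letter) : tailMax (Letter.b :: w) = tailMax w := by
  rw [tailMax, tailMax]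
  refine Finset.sum_congr (by simp) fun j _ => ?_
  rw [Finset.sum_range_succ', Finset.sum_range_succ']
  simp [blockCount_cons_succ _ (show Letter.b ≠ Letter.hash by decide),
    blockCount_cons_zero _ (show Letter.b ≠ Letter.hash by decide)]

theorem tailMax_hash_cons (w : List Letter) :
    tailMax (Letter.hash :: w) = tailMax w + MaxPlus.ofNat (blockCount Letter.b w 0) := by
  rw [← ofNat_blockMax, blockMax, MaxPlus.ofNat_sup_range_succ, tailMax]
  refine Finset.sum_congr (by simp) fun j _ => ?_
  rw [Finset.sum_range_succ']
  simp [blockCount_hash_cons_succ, blockCount_hash_cons_zero]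

/-- The registers of `ℬ` after reading the reverse of `w`, if `x` starts with the value `s`. -/
def reverseVal (s : MaxPlus) (w : List Letter) : Reg → MaxPlus
  | .x => s * MaxPlus.ofNat (w.count Letter.a) + tailMax w
  | .y => MaxPlus.ofNat (blockCount Letter.b w 0)

theorem run_automatonBFrom_reverse (s : MaxPlus) (w : List Letter) :
    (automatonBFrom s).run w.reverse = ((), reverseVal s w) := by
  induction w with
  | nil =>
    refine Prod.ext rfl (funext fun r => ?_)
    cases r
    · exact ((add_zero _).trans (mul_one s)).symm
    · simp only [reverseVal, blockCount_nil]
      rfl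
  | cons c w ih =>
    rw [run_automatonBFrom_reverse_cons, ih]
    refine Prod.ext rfl (funext fun r => ?_)
    cases c <;> cases r <;>
      simp [CRA.step, automatonB, substB, eval, reverseVal, tailMax_a_cons, tailMax_b_cons,
        tailMax_hash_cons, blockCount_cons_zero, blockCount_hash_cons_zero, ← MaxPlus.ofNat_mul,
        add_mul, mul_assoc, add_assoc]

theorem output_automatonBFrom_reverse (s : MaxPlus) (w : List Letter) :
    (automatonBFrom s).output w.reverse =
      s * MaxPlus.ofNat (w.count Letter.a) + MaxPlus.ofNat (blockMax w) := by
  rw [CRA.output, run_automatonBFrom_reverse, ofNat_blockMax, ← add_assoc]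
  rfl

theorem fBR_eq (w : List Letter) :
    fBR w = MaxPlus.ofNat (max (w.count Letter.a) (blockMax w)) := by
  rw [fBR, ← automatonBFrom_one, output_automatonBFrom_reverse, one_mul, MaxPlus.ofNat_add]

theorem fBR_eq_scanMax (w : List Letter) : fBR w = MaxPlus.ofNat (scanMax w) := by
  have h : ∀ w : List Letter, (automatonBFrom 1).run w.reverse = ((), fun
      | .x => MaxPlus.ofNat (w.foldr scanStep (0, 0)).1
      | .y => MaxPlus.ofNat (w.foldr scanStep (0, 0)).2) := by
    intro w
    induction w with
    | nil => exact Prod.ext rfl (funext fun r => by cases r <;> rfl)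
    | cons c w ih =>
      rw [run_automatonBFrom_reverse_cons, ih]
      refine Prod.ext rfl (funext fun r => ?_)
      cases c <;> cases r <;>
        simp [CRA.step, automatonB, substB, eval, scanStep, MaxPlus.ofNat_mul, MaxPlus.ofNat_add]
  rw [fBR, CRA.output, ← automatonBFrom_one, h, scanMax, ← MaxPlus.ofNat_add]
  rfl

/-- Reading a first `#` turns the initial values `(-∞, 0)` of the registers into `(0, 0)` and
leaves `(0, 0)` unchanged. -/
theorem ofNat_blockMax_append_hash (w : List Letter) :
    MaxPlus.ofNat (blockMax (w ++ [Letter.hash])) =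
      MaxPlus.ofNat (scanMax (w ++ [Letter.hash])) := by
  have h0 := output_automatonBFrom_reverse 0 (w ++ [Letter.hash])
  rw [zero_mul, zero_add] at h0
  rw [← h0, ← fBR_eq_scanMax, fBR, ← automatonBFrom_one, CRA.output, CRA.output]
  have h : (automatonBFrom 0).run (w ++ [Letter.hash]).reverse =
      (automatonBFrom 1).run (w ++ [Letter.hash]).reverse := by
    rw [List.reverse_append, CRA.run, CRA.run]
    change w.reverse.foldl automatonB.step _ = w.reverse.foldl automatonB.step _
    congr 1
    exact Prod.ext rfl (funext fun r => by cases r <;> rfl)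
  rw [h]
  rfl

theorem mainTheorem1 :
    -- the function `max_j (n_0 + ⋯ + n_{j-1}) + m_j` and its reverse
    (¬ CopylessComputable (fun w : List Letter => MaxPlus.ofNat (blockMax w)) ∧
      CopylessComputable (fun w : List Letter => MaxPlus.ofNat (blockMax w.reverse))) ∧
    -- the reverse of the function computed by the copyless automaton `ℬ`
    (¬ CopylessComputable fBR ∧
      automatonB.Copyless ∧
      CopylessComputable (fun w : List Letter => fBR w.reverse)) ∧
    -- how the two functions are related
    ∀ w : List Letter, fBR w = MaxPlus.ofNat (max (w.count Letter.a) (blockMax w)) := by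
  refine ⟨⟨not_copylessComputable_of_eq_scanMax ofNat_blockMax_append_hash, ?_⟩,
    ⟨not_copylessComputable_of_eq_scanMax fun w => fBR_eq_scanMax _, automatonB_copyless, ?_⟩,
    fBR_eq⟩
  · refine ⟨Unit, Reg, inferInstance, inferInstance, automatonBFrom 0, automatonBFrom_copyless 0,
      fun w => ?_⟩
    have h := output_automatonBFrom_reverse 0 w.reverse
    rwa [List.reverse_reverse, zero_mul, zero_add] at h
  · refine ⟨Unit, Reg, inferInstance, inferInstance, automatonB, automatonB_copyless, fun w => ?_⟩
    change _ = fBR w.reverse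
    rw [fBR, List.reverse_reverse]
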